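/- Let $(w_n)_{n\ge 1}$ be non-negative real numbers with $w_1>0$, and put $W_n=\sum_{i=1}^n w_i$ and $a_n=\sum_{i=1}^n w_i/W_i$. Let $(\mathtt T_n)_{n\ge1}$ be the weighted recursive tree with weights $(w_n)_{n\geq 1}$: $\mathtt T_1$ consists of the root, labelled $1$, and, for $n\ge1$, $\mathtt T_{n+1}$ is obtained from $\mathtt T_n$ by adding a vertex labelled $n+1$ whose parent is the vertex labelled $K_{n+1}\in\{1,\dots,n\}$, where $\mathbb P(K_{n+1}=k\mid \mathtt T_n)=w_k/W_n$ for $1\le k\le n$. Let $H(\mathtt T_n)$ be the height of $\mathtt T_n$, that is, the maximal distance of a vertex of $\mathtt T_n$ to the root. Let $\alpha>0$ and let $L\colon[1,\infty)\to(0,\infty)$ be twice differentiable with $xL'(x)/L(x)\to0$ and $x^2L''(x)/L(x)\to0$ as $x\to\infty$ (condition $(\mathrm{SV}_2)$). Assume that, as $n\to\infty$, $$a_n=\int_1^{\log n}x^{-\alpha}L(x)\,\mathrm dx+o\left((\log n)^{-1-\alpha}(\log\log n)^2L(\log n)\right)$$ and $$\sum_{i\ge n}\frac{w_i^2}{W_i^2}=O\left(\frac1n\right).$$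 Then, for all $n$ large enough, the series below converges, and almost surely, as $n\to\infty$, $$H(\mathtt T_n)=\frac{\log n}{\alpha\log\log n}+\frac{\log n}{(\alpha\log\log n)^2}\left(\sum_{k\ge0}\left(\frac{\log L(\log n)}{\alpha\log\log n}\right)^k\bigl[\log L(\log n)+(k+1)\log\log\log n\bigr]+1+\alpha+\log\alpha+o(1)\right).$$ -/

import Mathlib

open MeasureTheory ProbabilityTheory Filter Topology Asymptotics

noncomputable section

namespace WRT

/-- `W_n = w_1 + ⋯ + w_n`. Weights are indexed by `1, 2, 3, …`; the value `w 0` is never used. -/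
def totalWeight (w : ℕ → ℝ) (n : ℕ) : ℝ :=
  ∑ i ∈ Finset.Icc 1 n, w i

/-- `a_n = ∑_{i=1}^n w_i / W_i`. -/
def aSeq (w : ℕ → ℝ) (n : ℕ) : ℝ :=
  ∑ i ∈ Finset.Icc 1 n, w i / totalWeight w i

/-- The information contained in the labelled rooted tree `T_n` on the vertices `1, …, n` with
root `1`: it is generated by the labels `K_2, …, K_n` of the parents of the vertices `2, …, n`. -/
abbrev treeSigma {Ω : Type*} (K : ℕ → Ω → ℕ) (n : ℕ) : MeasurableSpace Ω :=
  ⨆ m ∈ Set.Icc 2 n, MeasurableSpace.comap (K m) ⊤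

/-- `K` is the sequence of parent labels of a weighted recursive tree with weights
`(w_n)_{n ≥ 1}`: the vertex `n + 1` is attached to the vertex `K (n + 1) ∈ {1, …, n}` of `T_n`,
and `P(K_{n+1} = k | T_n) = w_k / W_n` for `1 ≤ k ≤ n`. -/
structure IsWRT {Ω : Type*} [MeasurableSpace Ω] (μ : Measure Ω) (w : ℕ → ℝ)
    (K : ℕ → Ω → ℕ) : Prop where
  measurable_parent : ∀ n, 1 ≤ n → Measurable (K (n + 1))
  parent_mem : ∀ n, 1 ≤ n → ∀ ω, K (n + 1) ω ∈ Set.Icc 1 n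
  condProb_parent : ∀ n, 1 ≤ n → ∀ k ∈ Set.Icc 1 n,
    μ⟦K (n + 1) ⁻¹' {k} | treeSigma K n⟧ =ᵐ[μ] fun _ => w k / totalWeight w n

/-- Height of the vertex `m` in the rooted tree with root `1` and parent map `par`: the number of
steps from a vertex to its parent that lead from `m` to the root. -/
def vertexHeight (par : ℕ → ℕ) (m : ℕ) : ℕ :=
  sInf {j : ℕ | par^[j] m = 1}

/-- Height of the tree `T_n` on the vertices `1, …, n`. -/
def treeHeight (par : ℕ → ℕ) (n : ℕ) : ℕ :=
  (Finset.Icc 1 n).sup (vertexHeight par)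

/-- Condition `(SV_k)`, for `k ≥ 1`, on a function `L : [1, ∞) → (0, ∞)`: `L` is `k` times
differentiable on `[1, ∞)` (one-sided at `1`; the `k`-th derivative need not be continuous) and
`x ^ i * L^{(i)}(x) / L(x) → 0` as `x → ∞` for `1 ≤ i ≤ k`. -/
def SV (k : ℕ) (L : ℝ → ℝ) : Prop :=
  (∀ i < k, DifferentiableOn ℝ (iteratedDerivWithin i L (Set.Ici 1)) (Set.Ici 1)) ∧
  ∀ i ∈ Set.Icc 1 k,
    Tendsto (fun x : ℝ => x ^ i * iteratedDerivWithin i L (Set.Ici 1) x / L x) atTop (𝓝 0)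

/-- The `k`-th term
`(log L(log n) / (α log log n)) ^ k * (log L(log n) + (k + 1) log log log n)`
of the series in the expansion of the height. -/
def seriesTerm (α : ℝ) (L : ℝ → ℝ) (n k : ℕ) : ℝ :=
  (Real.log (L (Real.log n)) / (α * Real.log (Real.log n))) ^ k *
    (Real.log (L (Real.log n)) + ((k : ℝ) + 1) * Real.log (Real.log (Real.log n)))

end WRT

end

/-! Write x = log n, Λ = α log x and E(x) = Λ - log L(x). In the variable x the sequence a_n has
density e^{-E(x)}, and the window (e^j, e^{j+1}] carries mass b_j ~ e^{-E(j)}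
(`tendsto_windowMass`). With the cost D = E - log log x - log α, a path that climbs as fast as
possible spends about D - 1 units of x per generation. Since 1/(D - 1) ≈ 1/D + 1/Λ² while (x/D)' ≈
1/D - α/Λ², the height should be about x/D + (1 + α) x/Λ², which is `profile` with c = 0. For every
c > 0 the height is shown to lie, almost surely and eventually, between the profiles with parameters
-c and c.

Upper bound. Charge each vertex i the cost D(log i) and sum along the path to the root. The
exponential moment of this sum is at most exp(D + Σ (e^D - 1) w_i/W_i)
(`IsWRT.integral_exp_pathSum_le`). A window contributes about e^D b_j ≈ 1/Λ to the sum, hence about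
x/Λ in total. Markov's inequality and Borel–Cantelli put every path sum below `barrier`, that is x +
(1 + ε) x/Λ, up to a constant. Since D increases, a budget increment dg buys at most dg/D
generations, which turns the barrier into the profile (`IsParentMap.vertexHeight_le`).

Lower bound. Let Ψ(j, h) be the weight of vertices of height at least h among labels up to e^j. A
conditional second moment estimate and Borel–Cantelli give Ψ(j+1, h+1) ≥ Ψ(j, h+1) + (1 - ε) b_j
Ψ(j, h) as long as Ψ(j, h) is not much smaller than e^{-j} times the total weight
(`IsWRT.ae_eventually_recursion`). This is a Pascal recursion: over m windows, M generations cost a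
factor of about binom(m, M) e^{-ME} ≈ e^{-M(D-1)}. The threshold itself falls by e^{-m}, so m
slightly above M(D - 1) suffices, and blocks can be chained forever
(`LogLike.exists_height_of_recursion`).

Finally D = Λ - log L - log log x - log α is expanded. The series in the theorem is the sum of two
geometric-type series in log L/Λ (`hasSum_seriesTerm`), and `expansion_identity` makes the remainder
explicit. -/

noncomputable section

namespace WRT

/-! ### Functions that grow like a multiple of the logarithm -/

/-- `E` is eventually differentiable and behaves like `α log` at the level of derivatives:
`t E'(t) → α`. -/
structure LogLike (α : ℝ) (E : ℝ → ℝ) : Prop where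
  differentiable : ∀ᶠ t in atTop, DifferentiableAt ℝ E t
  tendsto_deriv : Tendsto (fun t => t * deriv E t) atTop (𝓝 α)

lemma LogLike.sub {α β : ℝ} {E F : ℝ → ℝ} (hE : LogLike α E) (hF : LogLike β F) :
    LogLike (α - β) (fun x => E x - F x) := by
  refine ⟨?_, ?_⟩
  · filter_upwards [hE.differentiable, hF.differentiable] with t h1 h2 using h1.sub h2
  · refine (hE.tendsto_deriv.sub hF.tendsto_deriv).congr' ?_
    filter_upwards [hE.differentiable, hF.differentiable] with t h1 h2
    rw [deriv_fun_sub h1 h2]; ring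

lemma LogLike.const (c : ℝ) : LogLike 0 (fun _ => c) :=
  ⟨Eventually.of_forall fun _ => by fun_prop, by simp⟩

lemma logLike_mul_log (α : ℝ) : LogLike α (fun x => α * Real.log x) := by
  refine ⟨?_, ?_⟩
  · filter_upwards [eventually_gt_atTop 0] with t ht
    exact (Real.differentiableAt_log ht.ne').const_mul α
  · refine tendsto_const_nhds.congr' ?_
    filter_upwards [eventually_gt_atTop 0] with t ht
    rw [deriv_const_mul α (Real.differentiableAt_log ht.ne'), Real.deriv_log]
    field_simp

lemma logLike_log_log : LogLike 0 (fun x => Real.log (Real.log x)) := by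
  have key : ∀ t : ℝ, 1 < t → HasDerivAt (fun x => Real.log (Real.log x))
      (t⁻¹ / Real.log t) t := fun t ht =>
    (Real.hasDerivAt_log (by positivity)).log (Real.log_pos ht).ne'
  refine ⟨?_, ?_⟩
  · filter_upwards [eventually_gt_atTop 1] with t ht using (key t ht).differentiableAt
  · refine (tendsto_inv_atTop_zero.comp Real.tendsto_log_atTop).congr' ?_
    filter_upwards [eventually_gt_atTop 1] with t ht
    rw [(key t ht).deriv, Function.comp]
    field_simp

/-- Mean value inequality with |E'(t)| ≤ C/t ≤ C/x on [x, ∞). It makes E constant up to o(1) over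
intervals of length o(x), in particular over logarithmically many unit windows. -/
lemma LogLike.eventually_lipschitz {α : ℝ} {E : ℝ → ℝ} (hE : LogLike α E) {C : ℝ}
    (hC : |α| < C) :
    ∀ᶠ x in atTop, ∀ t, x ≤ t → |E t - E x| ≤ C * (t - x) / x := by
  have h1 : ∀ᶠ t in atTop, |t * deriv E t| < C := (hE.tendsto_deriv.abs).eventually_lt_const hC
  obtain ⟨X, hX⟩ := (h1.and (hE.differentiable.and (eventually_gt_atTop 0))).exists_forall_of_atTop
  filter_upwards [eventually_ge_atTop X] with x hx t ht
  have hx0 : 0 < x := (hX x hx).2.2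
  have := (convex_Ici x).norm_image_sub_le_of_norm_deriv_le (f := E) (C := C / x)
    (fun y hy => (hX y (hx.trans hy)).2.1) (fun y hy => by
      have hy' : x ≤ y := hy
      have := (hX y (hx.trans hy)).1.le
      rw [abs_mul, abs_of_pos (hx0.trans_le hy')] at this
      rw [Real.norm_eq_abs, le_div_iff₀ hx0]
      nlinarith [abs_nonneg (deriv E y)]) (Set.self_mem_Ici) (Set.mem_Ici.2 ht)
  rw [Real.norm_eq_abs, Real.norm_eq_abs, abs_of_nonneg (sub_nonneg.2 ht)] at this
  calc _ ≤ _ := this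
    _ = _ := by ring

lemma LogLike.eventually_monotone {α : ℝ} {E : ℝ → ℝ} (hE : LogLike α E) (hα : 0 < α) :
    ∀ᶠ X in atTop, MonotoneOn E (Set.Ici X) := by
  have h1 : ∀ᶠ t in atTop, 0 < t * deriv E t := hE.tendsto_deriv.eventually_const_lt hα
  obtain ⟨X₀, hX⟩ := (h1.and (hE.differentiable.and (eventually_gt_atTop 0))).exists_forall_of_atTop
  filter_upwards [eventually_ge_atTop X₀] with X hXX
  refine monotoneOn_of_deriv_nonneg (convex_Ici X)
    (fun t ht => (hX t (hXX.trans ht)).2.1.continuousAt.continuousWithinAt)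
    (fun t ht => (hX t (hXX.trans (interior_subset ht))).2.1.differentiableWithinAt)
    (fun t ht => ?_)
  have := hX t (hXX.trans (interior_subset ht))
  exact (pos_of_mul_pos_right this.1 this.2.2.le).le

/-- For α < d < c the function d log - E is again of logarithmic type, with positive constant d - α,
hence eventually increasing and so bounded below. -/
lemma LogLike.eventually_div_log_lt {α c : ℝ} {E : ℝ → ℝ} (hE : LogLike α E) (hc : α < c) :
    ∀ᶠ t in atTop, E t / Real.log t < c := by
  obtain ⟨d, hαd, hdc⟩ := exists_between hc
  have hF := (logLike_mul_log d).sub hE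
  obtain ⟨X, hX⟩ := (hF.eventually_monotone (sub_pos.2 hαd)).exists
  have hlim : Tendsto (fun t => d + (E X - d * Real.log X) / Real.log t) atTop (𝓝 (d + 0)) :=
    tendsto_const_nhds.add (tendsto_const_nhds.div_atTop Real.tendsto_log_atTop)
  rw [add_zero] at hlim
  filter_upwards [hlim.eventually_lt_const hdc, eventually_ge_atTop X, eventually_gt_atTop 1]
    with t h1 h2 h3
  refine lt_of_le_of_lt ?_ h1
  have hl := Real.log_pos h3
  rw [div_le_iff₀ hl, add_mul, div_mul_cancel₀ _ hl.ne']
  have := hX Set.self_mem_Ici (Set.mem_Ici.2 h2) h2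
  simp only at this
  linarith

lemma LogLike.tendsto_div_log {α : ℝ} {E : ℝ → ℝ} (hE : LogLike α E) :
    Tendsto (fun t => E t / Real.log t) atTop (𝓝 α) := by
  refine tendsto_order.2 ⟨fun c hc => ?_, fun c hc => hE.eventually_div_log_lt hc⟩
  have hF := (LogLike.const 0).sub hE
  filter_upwards [hF.eventually_div_log_lt (c := -c) (by linarith)] with t ht
  rw [zero_sub, neg_div] at ht
  linarith

lemma LogLike.tendsto_atTop {α : ℝ} {E : ℝ → ℝ} (hE : LogLike α E) (hα : 0 < α) :
    Tendsto E atTop atTop := by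
  refine (hE.tendsto_div_log.pos_mul_atTop hα Real.tendsto_log_atTop).congr' ?_
  filter_upwards [eventually_gt_atTop 1] with t ht
  rw [div_mul_cancel₀ _ (Real.log_pos ht).ne']

/-! ### Cost, profile and barrier, and their slopes -/

/-- The logarithmic weight `log (α⁻¹ e^{E(x)} / log x)` attached to a vertex with label `e^x`. -/
def cost (α : ℝ) (E : ℝ → ℝ) (x : ℝ) : ℝ := E x - Real.log (Real.log x) - Real.log α

/-- The height profile `x / D(x) + (1 + α + c) x / (α log x)²`, where `D` is `cost α E`. -/
def profile (α : ℝ) (E : ℝ → ℝ) (c x : ℝ) : ℝ :=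
  x / cost α E x + (1 + α + c) * (x / (α * Real.log x) ^ 2)

/-- The barrier `x + (1 + ε) x / (α log x)`. -/
def barrier (α ε x : ℝ) : ℝ := x + (1 + ε) * (x / (α * Real.log x))

section Cost

variable {α : ℝ} {E : ℝ → ℝ}

lemma LogLike.cost (hE : LogLike α E) : LogLike α (cost α E) := by
  have := (hE.sub logLike_log_log).sub (LogLike.const (Real.log α))
  rw [sub_zero, sub_zero] at this
  exact this

lemma tendsto_mul_log_atTop (hα : 0 < α) : Tendsto (fun t => α * Real.log t) atTop atTop :=
  Real.tendsto_log_atTop.const_mul_atTop hα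

lemma LogLike.tendsto_div_mul_log (hE : LogLike α E) (hα : 0 < α) :
    Tendsto (fun t => E t / (α * Real.log t)) atTop (𝓝 1) := by
  have := hE.tendsto_div_log.div_const α
  rw [div_self hα.ne'] at this
  refine this.congr fun t => ?_
  rw [div_div, mul_comm]

lemma LogLike.tendsto_mul_log_div (hE : LogLike α E) (hα : 0 < α) :
    Tendsto (fun t => (α * Real.log t) / E t) atTop (𝓝 1) := by
  have := (hE.tendsto_div_mul_log hα).inv₀ one_ne_zero
  simpa using this

lemma hasDerivAt_div_mul_log (hα : 0 < α) {t : ℝ} (ht : 1 < t) :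
    HasDerivAt (fun x => x / (α * Real.log x))
      ((1 - 1 / Real.log t) / (α * Real.log t)) t := by
  have hl := Real.log_pos ht
  have := (hasDerivAt_id t).div ((Real.hasDerivAt_log (by positivity : t ≠ 0)).const_mul α)
    (by positivity)
  refine this.congr_deriv ?_
  simp only [id]
  field_simp

lemma hasDerivAt_div_mul_log_sq (hα : 0 < α) {t : ℝ} (ht : 1 < t) :
    HasDerivAt (fun x => x / (α * Real.log x) ^ 2)
      ((1 - 2 / Real.log t) / (α * Real.log t) ^ 2) t := by
  have hl := Real.log_pos ht
  have := (hasDerivAt_id t).div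
    (((Real.hasDerivAt_log (by positivity : t ≠ 0)).const_mul α).pow 2) (pow_pos (mul_pos hα hl) 2).ne'
  refine this.congr_deriv ?_
  simp only [id, Pi.pow_apply]
  field_simp
  ring

lemma eventually_hasDerivAt_barrier (hα : 0 < α) (ε : ℝ) :
    ∀ᶠ t in atTop, HasDerivAt (barrier α ε)
      (1 + (1 + ε) * ((1 - 1 / Real.log t) / (α * Real.log t))) t := by
  filter_upwards [eventually_gt_atTop 1] with t ht
  exact (hasDerivAt_id t).add ((hasDerivAt_div_mul_log hα ht).const_mul (1 + ε))

lemma LogLike.eventually_hasDerivAt_profile (hE : LogLike α E) (hα : 0 < α) (c : ℝ) :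
    ∀ᶠ t in atTop, HasDerivAt (profile α E c)
      ((WRT.cost α E t - t * deriv (WRT.cost α E) t) / WRT.cost α E t ^ 2 +
        (1 + α + c) * ((1 - 2 / Real.log t) / (α * Real.log t) ^ 2)) t := by
  filter_upwards [eventually_gt_atTop 1, hE.cost.differentiable,
    (hE.cost.tendsto_atTop hα).eventually_gt_atTop 0] with t ht hd hpos
  have h1 := (hasDerivAt_id t).div hd.hasDerivAt hpos.ne'
  refine HasDerivAt.add ?_ ((hasDerivAt_div_mul_log_sq hα ht).const_mul (1 + α + c))
  exact h1.congr_deriv (by simp)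

lemma tendsto_inv_log : Tendsto (fun t => 1 / Real.log t) atTop (𝓝 0) :=
  tendsto_const_nhds.div_atTop Real.tendsto_log_atTop

/-- (x/D)' = 1/D - xD'/D² with xD' → α and D ~ α log x. The resulting -α is cancelled by the α in
the coefficient 1 + α + c. -/
lemma LogLike.tendsto_deriv_profile (hE : LogLike α E) (hα : 0 < α) (c : ℝ) :
    Tendsto (fun t => (deriv (profile α E c) t - 1 / WRT.cost α E t) * (α * Real.log t) ^ 2)
      atTop (𝓝 (1 + c)) := by
  have h1 := hE.cost.tendsto_mul_log_div hα
  have h2 : Tendsto (fun t => -(t * deriv (WRT.cost α E) t) *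
      ((α * Real.log t) / WRT.cost α E t) ^ 2 + (1 + α + c) * (1 - 2 * (1 / Real.log t))) atTop
      (𝓝 (-α * 1 ^ 2 + (1 + α + c) * (1 - 2 * 0))) :=
    (hE.cost.tendsto_deriv.neg.mul (h1.pow 2)).add
      (tendsto_const_nhds.mul (tendsto_const_nhds.sub (tendsto_const_nhds.mul tendsto_inv_log)))
  have h3 : -α * 1 ^ 2 + (1 + α + c) * (1 - 2 * 0) = 1 + c := by ring
  rw [h3] at h2
  refine h2.congr' ?_
  filter_upwards [eventually_gt_atTop 1, hE.eventually_hasDerivAt_profile hα c,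
    (hE.cost.tendsto_atTop hα).eventually_gt_atTop 0] with t ht hd hpos
  rw [hd.deriv]
  have hl := Real.log_pos ht
  field_simp
  ring

lemma LogLike.tendsto_deriv_barrier (hE : LogLike α E) (hα : 0 < α) (ε : ℝ) :
    Tendsto (fun t => (deriv (barrier α ε) t / WRT.cost α E t - 1 / WRT.cost α E t) *
      (α * Real.log t) ^ 2) atTop (𝓝 (1 + ε)) := by
  have h1 := hE.cost.tendsto_mul_log_div hα
  have h2 : Tendsto (fun t => (1 + ε) * ((1 - 1 / Real.log t) *
      ((α * Real.log t) / WRT.cost α E t))) atTop (𝓝 ((1 + ε) * ((1 - 0) * 1))) :=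
    tendsto_const_nhds.mul ((tendsto_const_nhds.sub tendsto_inv_log).mul h1)
  rw [sub_zero, one_mul, mul_one] at h2
  refine h2.congr' ?_
  filter_upwards [eventually_gt_atTop 1, eventually_hasDerivAt_barrier hα ε,
    (hE.cost.tendsto_atTop hα).eventually_gt_atTop 0] with t ht hd hpos
  rw [hd.deriv]
  have hl := Real.log_pos ht
  field_simp
  ring

/-- The profile grows at least as fast as the barrier divided by the cost. -/
lemma LogLike.eventually_barrier_le_profile (hE : LogLike α E) (hα : 0 < α) {ε c : ℝ}
    (hεc : ε < c) :
    ∀ᶠ X in atTop, ∀ x y, X ≤ x → x ≤ y →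
      (barrier α ε y - barrier α ε x) * (1 / WRT.cost α E y) ≤
        profile α E c y - profile α E c x := by
  have h := (hE.tendsto_deriv_profile hα c).sub (hE.tendsto_deriv_barrier hα ε)
  have h' := h.eventually_const_lt (show (0 : ℝ) < 1 + c - (1 + ε) by linarith)
  have hb : Tendsto (fun t => 1 + (1 + ε) * ((1 - 1 / Real.log t) / (α * Real.log t))) atTop
      (𝓝 (1 + (1 + ε) * 0)) :=
    tendsto_const_nhds.add (tendsto_const_nhds.mul
      ((tendsto_const_nhds.sub tendsto_inv_log).div_atTop (tendsto_mul_log_atTop hα)))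
  rw [mul_zero, add_zero] at hb
  obtain ⟨X₀, hX⟩ := (h'.and ((hE.eventually_hasDerivAt_profile hα c).and
    ((eventually_hasDerivAt_barrier hα ε).and ((hE.cost.tendsto_atTop hα).eventually_gt_atTop 0 |>.and
      ((eventually_gt_atTop 1).and (hb.eventually_const_lt one_pos)))))).exists_forall_of_atTop
  filter_upwards [eventually_ge_atTop X₀, hE.cost.eventually_monotone hα] with X hX₀ hmono x y hx hxy
  -- The cost is frozen at the right endpoint y. On [x, y] one has 1/D(y) ≤ 1/D(t), so it is enough
  -- to compare the slope of the profile with that of the barrier over D(t); in units of (α log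
  -- t)^{-2} their difference tends to c - ε > 0.
  have hmon : MonotoneOn (fun t => profile α E c t - barrier α ε t * (1 / WRT.cost α E y))
      (Set.Icc x y) := by
    have hin : ∀ t ∈ Set.Icc x y, X₀ ≤ t := fun t ht => hX₀.trans (hx.trans ht.1)
    have hder : ∀ t ∈ Set.Icc x y,
        HasDerivAt (fun t => profile α E c t - barrier α ε t * (1 / WRT.cost α E y))
        (deriv (profile α E c) t - deriv (barrier α ε) t * (1 / WRT.cost α E y)) t := fun t ht => by
      obtain ⟨_, h2, h3, _⟩ := hX t (hin t ht)
      exact h2.differentiableAt.hasDerivAt.sub (h3.differentiableAt.hasDerivAt.mul_const _)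
    refine monotoneOn_of_deriv_nonneg (convex_Icc x y)
      (fun t ht => (hder t ht).continuousAt.continuousWithinAt)
      (fun t ht => (hder t (interior_subset ht)).differentiableAt.differentiableWithinAt)
      (fun t ht => ?_)
    have ht' := interior_subset ht
    rw [(hder t ht').deriv]
    obtain ⟨h1, _, h3, h4, h5, h6⟩ := hX t (hin t ht')
    have hle : WRT.cost α E t ≤ WRT.cost α E y :=
      hmono (Set.mem_Ici.2 (hx.trans ht'.1)) (Set.mem_Ici.2 (hx.trans hxy)) ht'.2
    have hinv : 1 / WRT.cost α E y ≤ 1 / WRT.cost α E t := one_div_le_one_div_of_le h4 hle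
    have hl := Real.log_pos h5
    have hsq : 0 < (α * Real.log t) ^ 2 := by positivity
    rw [← sub_mul] at h1
    have h7 := pos_of_mul_pos_left h1 hsq.le
    have h8 : 0 < deriv (barrier α ε) t := by rw [h3.deriv]; exact h6
    have h9 := mul_le_mul_of_nonneg_left hinv h8.le
    rw [mul_one_div (deriv (barrier α ε) t) (WRT.cost α E t)] at h9
    linarith
  have := hmon (Set.left_mem_Icc.2 hxy) (Set.right_mem_Icc.2 hxy) hxy
  simp only at this
  linarith

end Cost

/-! ### Paths to the root in a recursive tree -/

/-- `par` is the parent map of a recursive tree rooted at `1`. -/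
def IsParentMap (par : ℕ → ℕ) : Prop := ∀ n, 1 ≤ n → par (n + 1) ∈ Set.Icc 1 n

/-- Sum of `f` along the path from `m` to the root, the root being excluded. -/
def pathSum (f : ℕ → ℝ) (par : ℕ → ℕ) (m : ℕ) : ℝ :=
  ∑ j ∈ Finset.range (vertexHeight par m), f (par^[j] m)

section Tree

variable {par : ℕ → ℕ}

lemma IsParentMap.mem (hp : IsParentMap par) {m : ℕ} (hm : 2 ≤ m) : 1 ≤ par m ∧ par m < m := by
  obtain ⟨n, rfl⟩ : ∃ n, m = n + 1 := ⟨m - 1, by omega⟩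
  have := hp n (by omega)
  exact ⟨this.1, Nat.lt_succ_of_le this.2⟩

lemma IsParentMap.exists_iterate (hp : IsParentMap par) (m : ℕ) (hm : 1 ≤ m) :
    ∃ j, par^[j] m = 1 := by
  induction m using Nat.strong_induction_on with
  | _ m ih =>
    rcases hm.eq_or_lt with rfl | h
    · exact ⟨0, rfl⟩
    · obtain ⟨h1, h2⟩ := hp.mem h
      obtain ⟨j, hj⟩ := ih _ h2 h1
      exact ⟨j + 1, by rwa [Function.iterate_succ_apply]⟩

@[simp] lemma vertexHeight_one (par : ℕ → ℕ) : vertexHeight par 1 = 0 :=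
  Nat.sInf_eq_zero.2 (Or.inl rfl)

lemma IsParentMap.vertexHeight_eq (hp : IsParentMap par) {m : ℕ} (hm : 2 ≤ m) :
    vertexHeight par m = vertexHeight par (par m) + 1 := by
  have hne : {j : ℕ | par^[j] m = 1}.Nonempty := hp.exists_iterate m (by omega)
  have h1 : 1 ≤ sInf {j : ℕ | par^[j] m = 1} := by
    by_contra h
    have h0 : sInf {j : ℕ | par^[j] m = 1} = 0 := by omega
    have := Nat.sInf_mem hne
    rw [h0] at this
    change m = 1 at this
    omega
  exact (Nat.sInf_add h1).symm

@[simp] lemma pathSum_one (f : ℕ → ℝ) (par : ℕ → ℕ) : pathSum f par 1 = 0 := by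
  simp [pathSum]

lemma IsParentMap.pathSum_eq (hp : IsParentMap par) (f : ℕ → ℝ) {m : ℕ} (hm : 2 ≤ m) :
    pathSum f par m = f m + pathSum f par (par m) := by
  rw [pathSum, hp.vertexHeight_eq hm, Finset.sum_range_succ', add_comm]
  simp [pathSum, Function.iterate_succ_apply]

lemma IsParentMap.vertexHeight_lt (hp : IsParentMap par) {m : ℕ} (hm : 1 ≤ m) :
    vertexHeight par m < m := by
  induction m using Nat.strong_induction_on with
  | _ m ih =>
    rcases hm.eq_or_lt with rfl | h
    · simp
    · obtain ⟨h1, h2⟩ := hp.mem h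
      have := ih _ h2 h1
      rw [hp.vertexHeight_eq h]
      omega

lemma IsParentMap.pathSum_eq_zero (hp : IsParentMap par) {f : ℕ → ℝ} {n₀ : ℕ}
    (hf : ∀ i ≤ n₀, f i = 0) {m : ℕ} (hm : 1 ≤ m) (hmn : m ≤ n₀) : pathSum f par m = 0 := by
  induction m using Nat.strong_induction_on with
  | _ m ih =>
    rcases hm.eq_or_lt with rfl | h
    · simp
    · obtain ⟨h1, h2⟩ := hp.mem h
      rw [hp.pathSum_eq f h, hf m hmn, ih _ h2 h1 (h2.le.trans hmn), add_zero]

/-- If the sums of `f` along the paths to the root stay below `g`, the heights stay below any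
function `u` whose increments dominate those of `g` divided by `f`. -/
lemma IsParentMap.vertexHeight_le (hp : IsParentMap par) {f v g u : ℕ → ℝ} {n₀ : ℕ} (hn₀ : 1 ≤ n₀)
    (hf : ∀ i ≤ n₀, f i = 0) (hvf : ∀ i, n₀ < i → v i * f i = 1)
    (hv_nonneg : ∀ i, n₀ ≤ i → 0 ≤ v i)
    (hv : ∀ k m, n₀ ≤ k → k ≤ m → v m ≤ v k)
    (hgu : ∀ k m, n₀ ≤ k → k ≤ m → (g m - g k) * v m ≤ u m - u k)
    (hS : ∀ m, n₀ < m → pathSum f par m ≤ g m) {m : ℕ} (hm : n₀ < m) :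
    (vertexHeight par m : ℝ) ≤ u m + (n₀ - u n₀ + |g n₀| * v n₀) := by
  -- The unspent budget g - S, where S is the path sum, is carried along at rate v. Going from the
  -- parent k to m, the extra f m in S costs v m * f m = 1 and pays exactly for the new generation;
  -- the old slack only shrinks because v decreases, and the new budget is controlled by u m - u k.
  suffices H : (vertexHeight par m : ℝ) + (g m - pathSum f par m) * v m ≤
      u m + (n₀ - u n₀ + |g n₀| * v n₀) by
    have := mul_nonneg (sub_nonneg.2 (hS m hm)) (hv_nonneg m hm.le)
    linarith
  induction m using Nat.strong_induction_on with
  | _ m ih =>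
    have hm2 : 2 ≤ m := by omega
    obtain ⟨h1, h2⟩ := hp.mem hm2
    rw [hp.pathSum_eq f hm2, hp.vertexHeight_eq hm2]
    push_cast
    have hvfm := hvf m hm
    rcases le_or_gt (par m) n₀ with hk | hk
    · rw [hp.pathSum_eq_zero hf h1 hk]
      have h3 : (vertexHeight par (par m) : ℝ) + 1 ≤ n₀ := by
        exact_mod_cast (hp.vertexHeight_lt h1).trans_le hk
      have h4 := hgu n₀ m le_rfl hm.le
      have h5 : g n₀ * v m ≤ |g n₀| * v n₀ :=
        mul_le_mul (le_abs_self _) (hv _ _ le_rfl hm.le) (hv_nonneg m hm.le) (abs_nonneg _)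
      nlinarith
    · have h3 := ih _ h2 hk
      have h4 := hgu _ m hk.le h2.le
      have h5 := mul_le_mul_of_nonneg_left (hv _ _ hk.le h2.le) (sub_nonneg.2 (hS _ hk))
      nlinarith

end Tree

/-! ### Upper bound on the height from a bound on path sums -/

section Profile

variable {α : ℝ} {E : ℝ → ℝ}

lemma tendsto_div_mul_log_sq (hα : 0 < α) :
    Tendsto (fun x => x / (α * Real.log x) ^ 2) atTop atTop := by
  have h : Tendsto (fun x => Real.log x ^ 2 / x) atTop (𝓝[>] 0) := by
    refine tendsto_nhdsWithin_iff.2 ⟨?_, ?_⟩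
    · exact (Real.isLittleO_pow_log_id_atTop (n := 2)).tendsto_div_nhds_zero
    · filter_upwards [eventually_gt_atTop 1] with x hx
      have := Real.log_pos hx
      exact Set.mem_Ioi.2 (by positivity)
  have h2 := (tendsto_inv_nhdsGT_zero.comp h).const_mul_atTop (show 0 < (α ^ 2)⁻¹ by positivity)
  refine h2.congr fun x => ?_
  simp only [Function.comp, inv_div]
  rw [mul_pow, div_mul_eq_div_div_swap, inv_mul_eq_div]

/-- The parameter c multiplies x / (α log x)², which tends to infinity; so an arbitrarily small
increase of c absorbs every additive constant. -/
lemma eventually_profile_add_le (hα : 0 < α) {c c' : ℝ} (hc : c < c') (B : ℝ) :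
    ∀ᶠ x in atTop, profile α E c x + B ≤ profile α E c' x := by
  filter_upwards [((tendsto_div_mul_log_sq hα).const_mul_atTop (sub_pos.2 hc)).eventually_ge_atTop B]
    with x hx
  unfold profile
  linarith

lemma LogLike.eventually_monotone_profile (hE : LogLike α E) (hα : 0 < α) {c : ℝ} (hc : -1 < c) :
    ∀ᶠ X in atTop, MonotoneOn (profile α E c) (Set.Ici X) := by
  have h := (hE.tendsto_deriv_profile hα c).eventually_const_lt (show (0 : ℝ) < 1 + c by linarith)
  obtain ⟨X₀, hX⟩ := (h.and ((hE.eventually_hasDerivAt_profile hα c).and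
    ((hE.cost.tendsto_atTop hα).eventually_gt_atTop 0 |>.and
      (eventually_gt_atTop 1)))).exists_forall_of_atTop
  filter_upwards [eventually_ge_atTop X₀] with X hXX
  refine monotoneOn_of_deriv_nonneg (convex_Ici X)
    (fun t ht => (hX t (hXX.trans ht)).2.1.continuousAt.continuousWithinAt)
    (fun t ht => (hX t (hXX.trans
      (interior_subset ht))).2.1.differentiableAt.differentiableWithinAt) (fun t ht => ?_)
  obtain ⟨h1, _, h3, h4⟩ := hX t (hXX.trans (interior_subset ht))
  have hl := Real.log_pos h4
  have h5 := pos_of_mul_pos_left h1 (sq_nonneg _)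
  have h6 : 0 < 1 / WRT.cost α E t := by positivity
  linarith

/-- The weight used along paths for the upper bound on the height: the cost at the logarithm of
the label for labels larger than `n₀`. -/
def labelCost (α : ℝ) (E : ℝ → ℝ) (n₀ i : ℕ) : ℝ :=
  if n₀ < i then cost α E (Real.log i) else 0

lemma tendsto_log_nat : Tendsto (fun n : ℕ => Real.log n) atTop atTop :=
  Real.tendsto_log_atTop.comp tendsto_natCast_atTop_atTop

/-- Apply the budget argument with f the label cost, v = 1/D, g the barrier plus C and u the profile
for some c' strictly between ε and c; passing from c' to c absorbs the constants. The cutoff n₀ does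
not depend on the tree, so it can be fixed before any randomness enters. -/
lemma LogLike.eventually_treeHeight_le (hE : LogLike α E) (hα : 0 < α) {ε c : ℝ}
    (hε : 0 < ε) (hεc : ε < c) :
    ∀ᶠ n₀ : ℕ in atTop, ∀ par, IsParentMap par →
      (∃ C, ∀ m, n₀ < m → pathSum (labelCost α E n₀) par m ≤ barrier α ε (Real.log m) + C) →
      ∀ᶠ n : ℕ in atTop, (treeHeight par n : ℝ) ≤ profile α E c (Real.log n) := by
  obtain ⟨c', hεc', hc'c⟩ := exists_between hεc
  have hall := (hE.eventually_barrier_le_profile hα hεc').and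
    ((hE.eventually_monotone_profile hα (c := c') (by linarith)).and
    ((hE.cost.eventually_monotone hα).and
      ((hE.cost.tendsto_atTop hα).eventually_gt_atTop 0)))
  filter_upwards [tendsto_log_nat.eventually hall, eventually_ge_atTop 1]
    with n₀ ⟨hgu, hmonoU, hmonoD, hD0⟩ hn₀ par hp ⟨C, hC⟩
  have hlog : ∀ {k m : ℕ}, n₀ ≤ k → k ≤ m → Real.log k ≤ Real.log m := fun {k m} hk hkm =>
    Real.log_le_log (by exact_mod_cast (by omega : 0 < k)) (by exact_mod_cast hkm)
  have hD : ∀ k m : ℕ, n₀ ≤ k → k ≤ m →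
      WRT.cost α E (Real.log k) ≤ WRT.cost α E (Real.log m) := fun k m hk hkm =>
    hmonoD (Set.mem_Ici.2 (hlog le_rfl hk)) (Set.mem_Ici.2 (hlog le_rfl (hk.trans hkm)))
      (hlog hk hkm)
  have hDpos : ∀ k : ℕ, n₀ ≤ k → 0 < WRT.cost α E (Real.log k) := fun k hk =>
    hD0.trans_le (hD n₀ k le_rfl hk)
  set B : ℝ := n₀ - profile α E c' (Real.log n₀) +
    |barrier α ε (Real.log n₀) + C| * (1 / WRT.cost α E (Real.log n₀)) with hB
  have key : ∀ m, n₀ < m → (vertexHeight par m : ℝ) ≤ profile α E c' (Real.log m) + B := by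
    intro m hm
    refine hp.vertexHeight_le (f := labelCost α E n₀)
      (v := fun m : ℕ => 1 / WRT.cost α E (Real.log m))
      (g := fun m : ℕ => barrier α ε (Real.log m) + C)
      (u := fun m : ℕ => profile α E c' (Real.log m)) hn₀ ?_ ?_ ?_ ?_ ?_ hC hm
    · intro i hi
      simp [labelCost, not_lt.2 hi]
    · intro i hi
      simp only [labelCost, hi, if_true]
      exact one_div_mul_cancel (hDpos i hi.le).ne'
    · intro i hi
      exact (one_div_pos.2 (hDpos i hi)).le
    · intro k m hk hkm
      exact one_div_le_one_div_of_le (hDpos k hk) (hD k m hk hkm)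
    · intro k m hk hkm
      have := hgu _ _ (hlog le_rfl hk) (hlog hk hkm)
      simpa using this
  have hB' := (eventually_profile_add_le (E := E) hα hc'c B)
  have hN := (eventually_profile_add_le (E := E) hα hc'c
    (n₀ - profile α E c' (Real.log n₀)))
  filter_upwards [tendsto_log_nat.eventually hB', tendsto_log_nat.eventually hN,
    eventually_ge_atTop n₀] with n h1 h2 h3
  have hle : ∀ m : ℕ, n₀ ≤ m → m ≤ n →
      profile α E c' (Real.log m) ≤ profile α E c' (Real.log n) := fun m hm hmn =>
    hmonoU (Set.mem_Ici.2 (hlog le_rfl hm)) (Set.mem_Ici.2 (hlog le_rfl h3)) (hlog hm hmn)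
  have hvert : ∀ m ∈ Finset.Icc 1 n, (vertexHeight par m : ℝ) ≤ profile α E c (Real.log n) := by
    intro m hm
    rw [Finset.mem_Icc] at hm
    rcases le_or_gt m n₀ with h | h
    · have h5 : (vertexHeight par m : ℝ) ≤ n₀ := by
        exact_mod_cast (hp.vertexHeight_lt hm.1).le.trans h
      have h6 := hle n₀ le_rfl h3
      linarith
    · have h5 := key m h
      have h6 := hle m h.le hm.2
      linarith
  obtain ⟨m, hm, hmeq⟩ := Finset.exists_mem_eq_sup (Finset.Icc 1 n)
    (Finset.nonempty_Icc.2 (hn₀.trans h3)) (vertexHeight par)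
  rw [treeHeight, hmeq]
  exact hvert m hm

end Profile

/-! ### Deterministic growth over one block of generations -/

/-- Binomial lower bound for an array satisfying a truncated Pascal-type recursion. -/
lemma choose_mul_le_of_recursion {Ψ : ℕ → ℕ → ℝ} {θ b : ℕ → ℝ} {j h m M : ℕ} {g β : ℝ}
    (hmono : ∀ i k, Ψ i k ≤ Ψ (i + 1) k) (hg : 0 ≤ g) (hβ0 : 0 ≤ β) (hβ1 : β ≤ 1)
    (hb : ∀ i < m, β ≤ b (j + i)) (hθ : ∀ i < m, θ (j + i) ≤ g * β ^ M)
    (hrec : ∀ i < m, ∀ k < M, k ≤ i → θ (j + i) ≤ Ψ (j + i) (h + k) →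
      Ψ (j + i) (h + k + 1) + b (j + i) * Ψ (j + i) (h + k) ≤ Ψ (j + i + 1) (h + k + 1))
    (h_init : g ≤ Ψ j h) (h_nonneg : ∀ i k, 0 ≤ Ψ i k) :
    ∀ i ≤ m, ∀ k ≤ M, g * (i.choose k * β ^ k) ≤ Ψ (j + i) (h + k) := by
  intro i
  induction i with
  | zero =>
    intro _ k _
    cases k with
    | zero => simpa using h_init
    | succ k => simpa using h_nonneg _ _
  | succ i ih =>
    intro hi k hk
    cases k with
    | zero =>
      have := ih (by omega) 0 (by omega)
      simp only [Nat.choose_zero_right, Nat.cast_one, pow_zero, mul_one, add_zero] at this ⊢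
      exact this.trans (hmono _ _)
    | succ k =>
      have h1 := ih (by omega) (k + 1) hk
      have h2 := ih (by omega) k (by omega)
      rw [Nat.choose_succ_succ]
      push_cast
      rcases Nat.eq_zero_or_pos (i.choose k) with h0 | h0
      · rw [h0, Nat.cast_zero, zero_add]
        exact h1.trans (hmono _ _)
      · have hc : (1 : ℝ) ≤ i.choose k := by exact_mod_cast h0
        have hβk : 0 ≤ β ^ k := pow_nonneg hβ0 k
        -- Every nonzero binomial lower bound is at least g * β ^ M, so the truncation threshold has
        -- to be compared only with this worst case.
        have h3 : g * β ^ M ≤ g * (i.choose k * β ^ k) := by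
          refine mul_le_mul_of_nonneg_left ?_ hg
          calc β ^ M ≤ β ^ k := pow_le_pow_of_le_one hβ0 hβ1 (by omega)
            _ ≤ i.choose k * β ^ k := by nlinarith
        have h4 := hrec i (by omega) k (by omega) (not_lt.1 fun hlt =>
          h0.ne' (Nat.choose_eq_zero_of_lt hlt)) (((hθ i (by omega)).trans h3).trans h2)
        have h5 : β * (g * (i.choose k * β ^ k)) ≤ b (j + i) * Ψ (j + i) (h + k) :=
          mul_le_mul (hb i (by omega)) h2 (by positivity) (hβ0.trans (hb i (by omega)))
        calc g * ((i.choose k + i.choose (k + 1)) * β ^ (k + 1))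
            = g * (i.choose (k + 1) * β ^ (k + 1)) + β * (g * (i.choose k * β ^ k)) := by ring
          _ ≤ _ := (add_le_add h1 h5).trans h4

lemma log_factorial_le {M : ℕ} (hM : 1 ≤ M) :
    Real.log (M.factorial) ≤ (M + 1) * Real.log M + 1 - M := by
  induction M, hM using Nat.le_induction with
  | base => simp
  | succ M hM ih =>
    have hM0 : (0 : ℝ) < M := by exact_mod_cast hM
    rw [Nat.factorial_succ]
    push_cast
    rw [Real.log_mul (by positivity) (by positivity)]
    have h1 := Real.one_sub_inv_le_log_of_pos (show (0 : ℝ) < (M + 1) / M by positivity)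
    rw [Real.log_div (by positivity) (by positivity), inv_div] at h1
    have h2 : 1 ≤ (M + 1 : ℝ) * (Real.log (M + 1) - Real.log M) := by
      have : 1 - (M : ℝ) / (M + 1) = 1 / (M + 1) := by field_simp; ring
      rw [this, div_le_iff₀ (by positivity)] at h1
      linarith
    linarith

/-- M is fixed so large that both the error in Stirling's formula and the rounding error 1 are at
most δM. -/
lemma exists_block_length {δ : ℝ} (hδ : 0 < δ) :
    ∃ M : ℕ, 1 ≤ M ∧ 1 ≤ δ * M ∧ Real.log M.factorial ≤ M * Real.log M - M + δ * M := by
  have h : Tendsto (fun x : ℝ => (Real.log x + 1) / x) atTop (𝓝 0) := by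
    have h1 := Real.isLittleO_log_id_atTop.tendsto_div_nhds_zero
    have h2 : Tendsto (fun x : ℝ => 1 / x) atTop (𝓝 0) :=
      tendsto_const_nhds.div_atTop tendsto_id
    simpa [add_div] using h1.add h2
  have h2 := (tendsto_natCast_atTop_atTop (R := ℝ)).eventually (h.eventually_lt_const hδ)
  have h3 := ((tendsto_natCast_atTop_atTop (R := ℝ)).const_mul_atTop hδ).eventually_ge_atTop 1
  obtain ⟨M, h2, h3, h4⟩ := (h2.and (h3.and (eventually_ge_atTop 1))).exists
  refine ⟨M, h4, h3, (log_factorial_le h4).trans ?_⟩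
  rw [div_lt_iff₀ (by exact_mod_cast h4)] at h2
  linarith

section Growth

variable {α : ℝ} {E : ℝ → ℝ}

/-- Number of unit windows needed for `M` generations. -/
def blockWindows (α : ℝ) (E : ℝ → ℝ) (δ : ℝ) (M : ℕ) (x : ℝ) : ℕ :=
  ⌈M * (cost α E x - 1 + 5 * δ)⌉₊

lemma LogLike.eventually_blockWindows (hE : LogLike α E) (hα : 0 < α) (δ : ℝ) {M : ℕ}
    (hM : 1 ≤ M) :
    ∀ᶠ x in atTop, M ≤ blockWindows α E δ M x ∧
      (blockWindows α E δ M x : ℝ) ≤ M * (WRT.cost α E x - 1 + 5 * δ) + 1 ∧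
      (blockWindows α E δ M x : ℝ) ≤ M * (α + 1) * Real.log x := by
  have hM0 : (0 : ℝ) < M := by exact_mod_cast hM
  have hM1 : (1 : ℝ) ≤ M := by exact_mod_cast hM
  have h1 := hE.cost.eventually_div_log_lt (c := α + 1 / 2) (by linarith)
  filter_upwards [(hE.cost.tendsto_atTop hα).eventually_ge_atTop (2 + 5 * |δ|), h1,
    Real.tendsto_log_atTop.eventually_ge_atTop (2 * (5 * |δ|)), eventually_gt_atTop 1]
    with x hx hlt hlog hx1
  have hd := neg_abs_le δ
  have hd' := le_abs_self δ
  have hl := Real.log_pos hx1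
  have hs : 1 ≤ WRT.cost α E x - 1 + 5 * δ := by linarith
  have hub : (blockWindows α E δ M x : ℝ) ≤ M * (WRT.cost α E x - 1 + 5 * δ) + 1 :=
    (Nat.ceil_lt_add_one (by positivity)).le
  refine ⟨?_, hub, hub.trans ?_⟩
  · have : (M : ℝ) ≤ blockWindows α E δ M x := by
      refine le_trans ?_ (Nat.le_ceil _)
      nlinarith
    exact_mod_cast this
  · rw [div_lt_iff₀ hl] at hlt
    have : (WRT.cost α E x - 1 + 5 * δ) * M + 1 ≤ (WRT.cost α E x + 5 * δ) * M := by nlinarith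
    have h2 : WRT.cost α E x + 5 * δ ≤ (α + 1) * Real.log x := by linarith
    nlinarith

/-- binom(m, M) ≥ (m + 1 - M)^M / M!, where (m + 1 - M)/M is at least D - 2 + 5δ ~ α log x. One δ is
lost in replacing this by α log x, the other in Stirling's formula, whose factor e^M produces the
+1. -/
lemma LogLike.eventually_le_choose (hE : LogLike α E) (hα : 0 < α) {δ : ℝ} (hδ : 0 < δ) {M : ℕ}
    (hM : 1 ≤ M) (hfac : Real.log M.factorial ≤ M * Real.log M - M + δ * M) :
    ∀ᶠ x in atTop, Real.exp (M * (Real.log (Real.log x) + Real.log α + 1 - 2 * δ)) ≤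
      (blockWindows α E δ M x).choose M := by
  have hM0 : (0 : ℝ) < M := by exact_mod_cast hM
  have hlim : Tendsto (fun x => (WRT.cost α E x - 2 + 5 * δ) / (α * Real.log x)) atTop (𝓝 1) := by
    have := (hE.cost.tendsto_div_mul_log hα).add
      ((tendsto_const_nhds (x := -2 + 5 * δ)).div_atTop (tendsto_mul_log_atTop hα))
    rw [add_zero] at this
    refine this.congr fun x => ?_
    rw [← add_div]; congr 1; ring
  have hexp : Real.exp (-δ) < 1 := by simpa using hδ
  filter_upwards [hE.eventually_blockWindows hα δ hM, hlim.eventually_const_lt hexp,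
    eventually_gt_atTop 1] with x ⟨hMm, _, _⟩ hlt hx
  set m := blockWindows α E δ M x with hm
  have hl := Real.log_pos hx
  rw [lt_div_iff₀ (by positivity)] at hlt
  have hm' : (M : ℝ) * (WRT.cost α E x - 1 + 5 * δ) ≤ m := Nat.le_ceil _
  have h1 : (M : ℝ) * (Real.exp (-δ) * (α * Real.log x)) ≤ (m + 1 - M : ℕ) := by
    rw [Nat.cast_sub (by omega)]
    push_cast
    nlinarith
  refine le_trans ?_ (Nat.pow_le_choose (α := ℝ) M m)
  rw [le_div_iff₀ (by positivity)]
  have h2 : (M.factorial : ℝ) ≤ Real.exp (M * Real.log M - M + δ * M) := by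
    rw [← Real.log_le_iff_le_exp (by positivity)]; exact hfac
  calc _ ≤ Real.exp (M * (Real.log (Real.log x) + Real.log α + 1 - 2 * δ)) *
        Real.exp (M * Real.log M - M + δ * M) := by gcongr
    _ = (Real.exp (Real.log M + (-δ + (Real.log α + Real.log (Real.log x))))) ^ M := by
        rw [← Real.exp_add, ← Real.exp_nat_mul]; congr 1; ring
    _ = (M * (Real.exp (-δ) * (α * Real.log x))) ^ M := by
        rw [Real.exp_add, Real.exp_add, Real.exp_add, Real.exp_log hM0, Real.exp_log hα,
          Real.exp_log hl]
    _ ≤ _ := by gcongr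

/-- During a block the slope of the profile stays below r = 1/D + (1 - 7δ)/Λ², and the block is no
longer than M(D - 1 + 6δ), the ceiling being paid for by 1 ≤ δM. The product is at most M because
r(D - 1 + 6δ) = 1 - (δ + o(1))/Λ. -/
lemma LogLike.eventually_profile_sub_le (hE : LogLike α E) (hα : 0 < α) {δ : ℝ} (hδ : 0 < δ)
    (hδ1 : 8 * δ < 1) {M : ℕ} (hM : 1 ≤ M) (hMδ : 1 ≤ δ * M) :
    ∀ᶠ x in atTop, ∀ y, x ≤ y → y ≤ x + blockWindows α E δ M x →
      profile α E (-(8 * δ)) y - profile α E (-(8 * δ)) x ≤ M := by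
  have hM0 : (0 : ℝ) < M := by exact_mod_cast hM
  have h1 := (hE.tendsto_deriv_profile hα (-(8 * δ))).eventually_lt_const
    (show 1 + -(8 * δ) < 1 - 7 * δ by linarith)
  obtain ⟨X₀, hX⟩ := (h1.and ((hE.eventually_hasDerivAt_profile hα (-(8 * δ))).and
    ((hE.cost.tendsto_atTop hα).eventually_gt_atTop 0 |>.and
      (eventually_gt_atTop 1)))).exists_forall_of_atTop
  have hlim : Tendsto (fun x => (-1 + 6 * δ) * ((α * Real.log x) / WRT.cost α E x) +
      (1 - 7 * δ) * (WRT.cost α E x / (α * Real.log x) + (-1 + 6 * δ) / (α * Real.log x))) atTop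
      (𝓝 ((-1 + 6 * δ) * 1 + (1 - 7 * δ) * (1 + 0))) :=
    (tendsto_const_nhds.mul (hE.cost.tendsto_mul_log_div hα)).add (tendsto_const_nhds.mul
      ((hE.cost.tendsto_div_mul_log hα).add
        (tendsto_const_nhds.div_atTop (tendsto_mul_log_atTop hα))))
  have hneg := hlim.eventually_lt_const
    (show (-1 + 6 * δ) * 1 + (1 - 7 * δ) * (1 + 0) < 0 by linarith)
  filter_upwards [eventually_ge_atTop X₀, hE.cost.eventually_monotone hα, hneg,
    hE.eventually_blockWindows hα δ hM, (hE.cost.tendsto_atTop hα).eventually_gt_atTop 1]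
    with x hx₀ hmono hneg ⟨_, hm, _⟩ hD1 y hxy hy
  obtain ⟨-, -, hD, hx1⟩ := hX x hx₀
  have hl := Real.log_pos hx1
  set Λ := α * Real.log x with hΛ
  have hΛ0 : 0 < Λ := by positivity
  set D := WRT.cost α E x with hDdef
  set r := 1 / D + (1 - 7 * δ) / Λ ^ 2 with hr
  have hr0 : 0 ≤ r := by
    have : 0 ≤ 1 - 7 * δ := by linarith
    positivity
  have hanti : AntitoneOn (fun t => profile α E (-(8 * δ)) t - r * t) (Set.Icc x y) := by
    have hder : ∀ t ∈ Set.Icc x y, HasDerivAt (fun t => profile α E (-(8 * δ)) t - r * t)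
        (deriv (profile α E (-(8 * δ))) t - r) t := fun t ht => by
      have := (hX t (hx₀.trans ht.1)).2.1.differentiableAt.hasDerivAt.sub
        ((hasDerivAt_id t).const_mul r)
      rwa [mul_one] at this
    refine antitoneOn_of_deriv_nonpos (convex_Icc x y)
      (fun t ht => (hder t ht).continuousAt.continuousWithinAt)
      (fun t ht => (hder t (interior_subset ht)).differentiableAt.differentiableWithinAt)
      (fun t ht => ?_)
    have ht' := interior_subset ht
    rw [(hder t ht').deriv]
    obtain ⟨h2, _, h3, h4⟩ := hX t (hx₀.trans ht'.1)
    have hlt := Real.log_pos h4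
    rw [← lt_div_iff₀ (by positivity)] at h2
    have h5 : 1 / WRT.cost α E t ≤ 1 / D := one_div_le_one_div_of_le hD
      (hmono Set.self_mem_Ici (Set.mem_Ici.2 ht'.1) ht'.1)
    have h6 : (1 - 7 * δ) / (α * Real.log t) ^ 2 ≤ (1 - 7 * δ) / Λ ^ 2 := by
      have : 0 ≤ 1 - 7 * δ := by linarith
      have h7 : Real.log x ≤ Real.log t := Real.log_le_log (by linarith) ht'.1
      rw [hΛ]
      gcongr
    linarith
  have hfin := hanti (Set.left_mem_Icc.2 hxy) (Set.right_mem_Icc.2 hxy) hxy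
  simp only at hfin
  have h8 : r * (D - 1 + 6 * δ) ≤ 1 := by
    have h9 : r * (D - 1 + 6 * δ) - 1 = ((-1 + 6 * δ) * (Λ / D) +
        (1 - 7 * δ) * (D / Λ + (-1 + 6 * δ) / Λ)) / Λ := by
      rw [hr]; field_simp; ring
    have := div_neg_of_neg_of_pos hneg hΛ0
    linarith
  have h10 : y - x ≤ M * (D - 1 + 6 * δ) := by nlinarith
  calc _ ≤ r * (y - x) := by linarith
    _ ≤ r * (M * (D - 1 + 6 * δ)) := by gcongr
    _ = M * (r * (D - 1 + 6 * δ)) := by ring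
    _ ≤ M * 1 := by gcongr
    _ = M := mul_one _

end Growth

/-! ### Iterating the truncated recursion -/

/-- `ζ` varies by at most `o(1)` upwards over windows of logarithmic length. -/
def SlowlyIncreasing (ζ : ℕ → ℝ) : Prop :=
  ∀ C δ : ℝ, 0 < C → 0 < δ → ∀ᶠ j : ℕ in atTop, ∀ i : ℕ, (i : ℝ) ≤ C * Real.log j →
    ζ (j + i) ≤ ζ j + δ

lemma SlowlyIncreasing.add {ζ η : ℕ → ℝ} (hζ : SlowlyIncreasing ζ) (hη : SlowlyIncreasing η) :
    SlowlyIncreasing (fun j => ζ j + η j) := by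
  intro C δ hC hδ
  filter_upwards [hζ C (δ / 2) hC (by linarith), hη C (δ / 2) hC (by linarith)] with j h1 h2 i hi
  have := h1 i hi
  have := h2 i hi
  linarith

lemma tendsto_log_div_nat : Tendsto (fun j : ℕ => Real.log j / j) atTop (𝓝 0) :=
  (Real.isLittleO_log_id_atTop.tendsto_div_nhds_zero).comp tendsto_natCast_atTop_atTop

lemma slowlyIncreasing_mul_log {K : ℝ} (hK : 0 ≤ K) :
    SlowlyIncreasing (fun j => K * Real.log j) := by
  intro C δ hC hδ
  have h : Tendsto (fun j : ℕ => K * C * (Real.log j / j)) atTop (𝓝 (K * C * 0)) :=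
    tendsto_const_nhds.mul tendsto_log_div_nat
  rw [mul_zero] at h
  filter_upwards [h.eventually_lt_const hδ, eventually_ge_atTop 1] with j h1 hj i hi
  have hj0 : (0 : ℝ) < j := by exact_mod_cast hj
  have h2 : Real.log ((j + i : ℕ) : ℝ) ≤ Real.log j + i / j := by
    have h3 := Real.log_le_sub_one_of_pos (show (0 : ℝ) < (j + i : ℕ) / j by positivity)
    rw [Real.log_div (by positivity) (by positivity)] at h3
    have h4 : ((j + i : ℕ) : ℝ) / j - 1 = i / j := by push_cast; field_simp; ring
    linarith
  have h5 : (i : ℝ) / j ≤ C * (Real.log j / j) := by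
    rw [← mul_div_assoc]; gcongr
  calc K * Real.log ((j + i : ℕ) : ℝ) ≤ K * (Real.log j + C * (Real.log j / j)) := by
        gcongr; linarith
    _ ≤ _ := by linarith

/-- A single step eventually raises ζ by at most 1/2, so ζ cannot keep pace with j. This puts the
threshold below the initial weight and starts the chain of blocks. -/
lemma SlowlyIncreasing.eventually_le {ζ : ℕ → ℝ} (hζ : SlowlyIncreasing ζ) (B : ℝ) :
    ∀ᶠ j : ℕ in atTop, -(j : ℝ) + ζ j ≤ B := by
  have h1 := hζ 1 (1 / 2) one_pos (by norm_num)
  obtain ⟨J, hJ⟩ := (h1.and (tendsto_log_nat.eventually_ge_atTop 1)).exists_forall_of_atTop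
  have h2 : ∀ k : ℕ, ζ (J + k) ≤ ζ J + k / 2 := by
    intro k
    induction k with
    | zero => simp
    | succ k ih =>
      obtain ⟨h3, h4⟩ := hJ (J + k) (by omega)
      have := h3 1 (by push_cast at h4 ⊢; linarith)
      push_cast
      rw [← add_assoc]
      linarith
  filter_upwards [eventually_ge_atTop J,
    tendsto_natCast_atTop_atTop.eventually_ge_atTop (2 * (ζ J - B))] with j hj hj2
  obtain ⟨k, rfl⟩ := Nat.exists_eq_add_of_le hj
  have := h2 k
  push_cast at hj2 ⊢
  have : (0 : ℝ) ≤ J := by positivity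
  linarith

section Recursion

variable {α : ℝ} {E : ℝ → ℝ}

/-- One common rate for a whole block. The loss δ is split into three equal parts: the factor from
the recursion, the comparison of b with e^{-E}, and the variation of E over C log j windows. -/
lemma LogLike.eventually_window_le (hE : LogLike α E) {b : ℕ → ℝ} {δ C : ℝ}
    (hδ : 0 < δ)
    (hb : Tendsto (fun j : ℕ => b j * Real.exp (E j)) atTop (𝓝 1)) :
    ∀ᶠ j : ℕ in atTop, ∀ i : ℕ, (i : ℝ) ≤ C * Real.log j →
      Real.exp (-(E j) - δ) ≤ Real.exp (-δ / 3) * b (j + i) := by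
  have h1 := hb.eventually_const_lt (show Real.exp (-δ / 3) < 1 by
    rw [Real.exp_lt_one_iff]; linarith)
  obtain ⟨J, hJ⟩ := h1.exists_forall_of_atTop
  have hlip := hE.eventually_lipschitz (C := |α| + 1) (by linarith)
  have hlim : Tendsto (fun j : ℕ => (|α| + 1) * C * (Real.log j / j)) atTop
      (𝓝 ((|α| + 1) * C * 0)) := tendsto_const_nhds.mul tendsto_log_div_nat
  rw [mul_zero] at hlim
  filter_upwards [eventually_ge_atTop J, (tendsto_natCast_atTop_atTop (R := ℝ)).eventually hlip,
    hlim.eventually_lt_const (show 0 < δ / 3 by linarith), eventually_ge_atTop 1]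
    with j hj hl hlt hj1 i hi
  have hj0 : (0 : ℝ) < j := by exact_mod_cast hj1
  have h2 := hJ (j + i) (by omega)
  have h3 := hl ((j + i : ℕ) : ℝ) (by push_cast; linarith [(Nat.cast_nonneg i : (0 : ℝ) ≤ i)])
  have h4 : E ((j + i : ℕ) : ℝ) ≤ E j + δ / 3 := by
    have h5 : (|α| + 1) * (((j + i : ℕ) : ℝ) - j) / j ≤ (|α| + 1) * C * (Real.log j / j) := by
      rw [← mul_div_assoc, mul_assoc]
      push_cast
      gcongr
      linarith
    have := le_abs_self (E ((j + i : ℕ) : ℝ) - E j)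
    linarith
  have h6 : Real.exp (-δ / 3) * Real.exp (-E ((j + i : ℕ) : ℝ)) ≤ b (j + i) := by
    rw [Real.exp_neg (E _), ← div_eq_mul_inv, div_le_iff₀ (Real.exp_pos _)]
    exact h2.le
  calc Real.exp (-(E j) - δ) ≤ Real.exp (-δ / 3 + (-δ / 3 + -E ((j + i : ℕ) : ℝ))) := by
        apply Real.exp_le_exp.2; linarith
    _ = Real.exp (-δ / 3) * (Real.exp (-δ / 3) * Real.exp (-E ((j + i : ℕ) : ℝ))) := by
        rw [Real.exp_add, Real.exp_add]
    _ ≤ _ := by gcongr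

/-- One block of `M` generations. -/
lemma LogLike.eventually_block (hE : LogLike α E) (hα : 0 < α) {δ : ℝ} (hδ : 0 < δ) {M : ℕ}
    (hM : 1 ≤ M) (hfac : Real.log M.factorial ≤ M * Real.log M - M + δ * M)
    {b ζ : ℕ → ℝ} {Ψ : ℕ → ℕ → ℝ}
    (hb : Tendsto (fun j : ℕ => b j * Real.exp (E j)) atTop (𝓝 1)) (hζ : SlowlyIncreasing ζ)
    (hmono : ∀ j h, Ψ j h ≤ Ψ (j + 1) h) (h_nonneg : ∀ j h, 0 ≤ Ψ j h)
    (hrec : ∀ᶠ j : ℕ in atTop, ∀ h ≤ j, Real.exp (-j + ζ j) ≤ Ψ j h →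
      Ψ j (h + 1) + Real.exp (-δ / 3) * b j * Ψ j h ≤ Ψ (j + 1) (h + 1)) :
    ∀ᶠ j : ℕ in atTop, ∀ h ≤ j,
      Real.exp (-j + (ζ j + (M * (α + 1) + 1) * Real.log j)) ≤ Ψ j h →
      Real.exp (-((j + blockWindows α E δ M j : ℕ) : ℝ) + (ζ (j + blockWindows α E δ M j) +
        (M * (α + 1) + 1) * Real.log ((j + blockWindows α E δ M j : ℕ) : ℝ))) ≤
        Ψ (j + blockWindows α E δ M j) (h + M) := by
  have hM0 : (0 : ℝ) < M := by exact_mod_cast hM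
  have hM1 : (1 : ℝ) ≤ M := by exact_mod_cast hM
  have hC : 0 < M * (α + 1) := by positivity
  -- A safety margin above the threshold, needed since the lower bounds inside a block may drop by β
  -- ^ M. As E(j) ≤ (α + 1) log j, the part M(α + 1) log j pays for e^{-ME}, and the extra log j
  -- pays for Mδ + δ.
  set K : ℝ := M * (α + 1) + 1 with hK
  obtain ⟨J, hJ⟩ := hrec.exists_forall_of_atTop
  have hcast := tendsto_natCast_atTop_atTop (R := ℝ)
  have hE1 : ∀ᶠ x in atTop, E x / Real.log x < α + 1 := hE.eventually_div_log_lt (by linarith)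
  have hlogbig := tendsto_log_nat.eventually_ge_atTop (M * δ + δ)
  filter_upwards [eventually_ge_atTop J, hcast.eventually (hE.eventually_blockWindows hα δ hM),
    hcast.eventually (hE.eventually_le_choose hα hδ hM hfac),
    hE.eventually_window_le (C := M * (α + 1)) hδ hb, hζ _ δ hC hδ,
    (hζ.add (slowlyIncreasing_mul_log (K := K) (by positivity))) _ δ hC hδ,
    hcast.eventually hE1, hlogbig, hcast.eventually (eventually_gt_atTop 1),
    hcast.eventually ((hE.tendsto_atTop hα).eventually_ge_atTop 0)]
    with j hjJ ⟨hMm, _, hmlog⟩ hchoose hwin hζ1 hζ2 hE1 hlog hj1 hE0 h hhj hinit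
  set m := blockWindows α E δ M j with hm
  have hl := Real.log_pos hj1
  rw [div_lt_iff₀ hl] at hE1
  set g := Real.exp (-j + (ζ j + K * Real.log j)) with hg
  set β := Real.exp (-(E j) - δ) with hβ
  have hile : ∀ i ≤ m, (i : ℝ) ≤ M * (α + 1) * Real.log j := fun i hi =>
    (Nat.cast_le.2 hi).trans hmlog
  have key := choose_mul_le_of_recursion (Ψ := Ψ) (θ := fun j => Real.exp (-j + ζ j))
    (b := fun j => Real.exp (-δ / 3) * b j) (j := j) (h := h) (m := m) (M := M) (g := g) (β := β)
    hmono (Real.exp_pos _).le (Real.exp_pos _).le (Real.exp_le_one_iff.2 (by linarith))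
    (fun i hi => hwin i (hile i hi.le)) (fun i hi => ?_) (fun i hi k hk hki hΨ => ?_)
    hinit h_nonneg m le_rfl M le_rfl
  · refine le_trans ?_ key
    have h1 : β ^ M = Real.exp (M * (-(E j) - δ)) := by rw [hβ, ← Real.exp_nat_mul]
    -- The exponents add up to -M(D - 1 + 3δ), whereas m ≥ M(D - 1 + 5δ). The spare 2Mδ covers the
    -- increase of ζ and of K log over the block, so the margin is restored at its end.
    calc _ ≤ g * (Real.exp (M * (Real.log (Real.log j) + Real.log α + 1 - 2 * δ)) *
          Real.exp (M * (-(E j) - δ))) := by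
          rw [hg, ← Real.exp_add, ← Real.exp_add]
          apply Real.exp_le_exp.2
          have h2 := hζ2 m (hile m le_rfl)
          have h3 : (M : ℝ) * (WRT.cost α E j - 1 + 5 * δ) ≤ m := Nat.le_ceil _
          rw [WRT.cost] at h3
          push_cast at h2 ⊢
          have h4 : δ ≤ M * δ := by nlinarith
          linarith
      _ ≤ g * (m.choose M * β ^ M) := by
          rw [h1]; gcongr
  · rw [hg, hβ, ← Real.exp_nat_mul, ← Real.exp_add]
    apply Real.exp_le_exp.2
    have h2 := hζ1 i (hile i hi.le)
    have h3 : (0 : ℝ) ≤ i := Nat.cast_nonneg i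
    have h4 : (M : ℝ) * E j ≤ M * ((α + 1) * Real.log j) := by gcongr
    push_cast
    rw [hK]
    linarith
  · exact hJ (j + i) (by omega) (h + k) (by omega) hΨ

/-- Blocks are chained from a fixed window at height 0: each gains M generations while the profile
gains at most M. The loss ε depends only on c, so it can be chosen before the recursion is known to
hold. -/
lemma LogLike.exists_height_of_recursion (hE : LogLike α E) (hα : 0 < α) {c : ℝ} (hc : 0 < c) :
    ∃ ε : ℝ, 0 < ε ∧ ε < 1 ∧ ∀ (b ζ : ℕ → ℝ) (Ψ : ℕ → ℕ → ℝ) (w₀ : ℝ),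
      Tendsto (fun j : ℕ => b j * Real.exp (E j)) atTop (𝓝 1) → SlowlyIncreasing ζ →
      (∀ j h, Ψ j h ≤ Ψ (j + 1) h) → (∀ j h, 0 ≤ Ψ j h) → 0 < w₀ →
      (∀ᶠ j in atTop, w₀ ≤ Ψ j 0) →
      (∀ᶠ j : ℕ in atTop, ∀ h ≤ j, Real.exp (-j + ζ j) ≤ Ψ j h →
        Ψ j (h + 1) + (1 - ε) * b j * Ψ j h ≤ Ψ (j + 1) (h + 1)) →
      ∀ᶠ x in atTop, ∃ h : ℕ, profile α E (-c) x ≤ h ∧ 0 < Ψ ⌊x⌋₊ h := by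
  obtain ⟨δ, hδ, hδ1, hδc⟩ : ∃ δ : ℝ, 0 < δ ∧ 8 * δ < 1 ∧ 8 * δ < c :=
    ⟨min 1 c / 16, by positivity, by linarith [min_le_left 1 c], by linarith [min_le_right 1 c]⟩
  obtain ⟨M, hM, hMδ, hfac⟩ := exists_block_length hδ
  refine ⟨1 - Real.exp (-δ / 3), ?_, ?_, ?_⟩
  · rw [sub_pos, Real.exp_lt_one_iff]; linarith
  · linarith [Real.exp_pos (-δ / 3)]
  intro b ζ Ψ w₀ hb hζ hmono h_nonneg hw₀ hinit hrec
  simp only [sub_sub_cancel] at hrec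
  have hblock := hE.eventually_block hα hδ hM hfac hb hζ hmono h_nonneg hrec
  set K : ℝ := M * (α + 1) + 1 with hK
  have hK0 : 0 ≤ K := by positivity
  have hsmall := (hζ.add (slowlyIncreasing_mul_log hK0)).eventually_le (Real.log w₀)
  have hcast := tendsto_natCast_atTop_atTop (R := ℝ)
  obtain ⟨J, hJ⟩ := (hblock.and ((hcast.eventually
    (hE.eventually_profile_sub_le hα hδ hδ1 hM hMδ)).and
    (hcast.eventually (hE.eventually_blockWindows hα δ hM)))).exists_forall_of_atTop
  obtain ⟨J₁, hJ₁⟩ := (hsmall.and hinit).exists_forall_of_atTop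
  set J₂ := max J J₁ with hJ₂
  have hJJ : J ≤ J₂ := le_max_left _ _
  set U := profile α E (-(8 * δ)) with hU
  -- Here j is the start of the block containing the window J₂ + k. The invariant h ≤ j survives
  -- because a block has at least M windows; it is needed since the recursion is assumed only for
  -- such heights.
  have key : ∀ k : ℕ, ∃ j h : ℕ, J₂ ≤ j ∧ j ≤ J₂ + k ∧ J₂ + k < j + blockWindows α E δ M j ∧ h ≤ j ∧
      Real.exp (-j + (ζ j + K * Real.log j)) ≤ Ψ j h ∧ U j - U J₂ ≤ h := by
    intro k
    induction k with
    | zero =>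
      refine ⟨J₂, 0, le_rfl, le_rfl, ?_, Nat.zero_le _, ?_, by simp⟩
      · have := (hJ J₂ hJJ).2.2.1
        omega
      · obtain ⟨h1, h2⟩ := hJ₁ J₂ (le_max_right _ _)
        refine le_trans ?_ h2
        rwa [← Real.le_log_iff_exp_le hw₀]
    | succ k ih =>
      obtain ⟨j, h, hj1, hj2, hj3, hh, hΨ, hUh⟩ := ih
      obtain ⟨hb1, hb2, hb3, _⟩ := hJ j (hJJ.trans hj1)
      rcases Nat.lt_or_ge (J₂ + (k + 1)) (j + blockWindows α E δ M j) with hlt | hge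
      · exact ⟨j, h, hj1, by omega, hlt, hh, hΨ, hUh⟩
      · refine ⟨j + blockWindows α E δ M j, h + M, by omega, by omega, ?_, by omega,
          hb1 h hh hΨ, ?_⟩
        · have := (hJ (j + blockWindows α E δ M j) (by omega)).2.2.1
          omega
        · have := hb2 ((j + blockWindows α E δ M j : ℕ) : ℝ) (by push_cast; simp)
            (by push_cast; simp)
          push_cast at this ⊢
          linarith
  filter_upwards [eventually_profile_add_le (E := E) hα
    (show -c < -(8 * δ) by linarith) (M + U J₂), eventually_ge_atTop ((J₂ : ℕ) : ℝ)]
    with x hx hxJ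
  have hfl : J₂ ≤ ⌊x⌋₊ := Nat.le_floor hxJ
  obtain ⟨k, hk⟩ := Nat.exists_eq_add_of_le hfl
  obtain ⟨j, h, hj1, hj2, hj3, hh, hΨ, hUh⟩ := key k
  rw [← hk] at hj2 hj3
  have hx0 : 0 ≤ x := (Nat.cast_nonneg _).trans hxJ
  have hxj : (j : ℝ) ≤ x := (Nat.cast_le.2 hj2).trans (Nat.floor_le hx0)
  have hxj' : x ≤ j + blockWindows α E δ M j := by
    have h1 := (Nat.lt_floor_add_one x).le
    have h2 : ((⌊x⌋₊ : ℕ) : ℝ) + 1 ≤ ((j + blockWindows α E δ M j : ℕ) : ℝ) := by exact_mod_cast hj3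
    push_cast at h2
    linarith
  refine ⟨h, ?_, ?_⟩
  · have := (hJ j (hJJ.trans hj1)).2.1 x hxj hxj'
    linarith
  · refine lt_of_lt_of_le (Real.exp_pos _) (hΨ.trans ?_)
    exact monotone_nat_of_le_succ (f := fun j => Ψ j h) (fun j => hmono j h) hj2

/-! ### Measurability, averaging over a parent, exponential moments of path sums -/

lemma treeSigma_mono {Ω : Type*} (K : ℕ → Ω → ℕ) {m n : ℕ} (h : m ≤ n) : treeSigma K m ≤ treeSigma K n :=
  biSup_mono fun _ hi => ⟨hi.1, hi.2.trans h⟩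

lemma measurable_parent_treeSigma {Ω : Type*} (K : ℕ → Ω → ℕ) {m n : ℕ} (hm : 2 ≤ m) (hmn : m ≤ n) :
    Measurable[treeSigma K n] (K m) :=
  measurable_iff_comap_le.2 (le_biSup (fun m => MeasurableSpace.comap (K m) ⊤)
    (show m ∈ Set.Icc 2 n from ⟨hm, hmn⟩))

section Weights

variable {w : ℕ → ℝ}

lemma totalWeight_succ (w : ℕ → ℝ) (n : ℕ) :
    totalWeight w (n + 1) = totalWeight w n + w (n + 1) :=
  Finset.sum_Icc_succ_top (by omega) _

lemma totalWeight_mono (hw : ∀ i, 1 ≤ i → 0 ≤ w i) : Monotone (totalWeight w) :=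
  monotone_nat_of_le_succ fun n => by
    rw [totalWeight_succ]; linarith [hw (n + 1) (by omega)]

lemma totalWeight_pos (hw : ∀ i, 1 ≤ i → 0 ≤ w i) (hw1 : 0 < w 1) {n : ℕ} (hn : 1 ≤ n) :
    0 < totalWeight w n := by
  refine lt_of_lt_of_le ?_ (totalWeight_mono hw hn)
  simpa [totalWeight] using hw1

end Weights

section Probability

variable {Ω : Type*} [MeasurableSpace Ω] {μ : Measure Ω} {w : ℕ → ℝ} {K : ℕ → Ω → ℕ}

lemma IsWRT.isParentMap (hK : IsWRT μ w K) (ω : Ω) : IsParentMap (fun m => K m ω) :=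
  fun n hn => hK.parent_mem n hn ω

lemma IsWRT.treeSigma_le (hK : IsWRT μ w K) (n : ℕ) : treeSigma K n ≤ ‹MeasurableSpace Ω› := by
  refine iSup₂_le fun m hm => ?_
  obtain ⟨k, rfl⟩ : ∃ k, m = k + 1 := ⟨m - 1, by have := hm.1; omega⟩
  exact (hK.measurable_parent k (by have := hm.1; omega)).comap_le

/-- Such a function depends only on the labels K_2, …, K_n, which take finitely many values.
Boundedness and integrability of everything measurable in T_n follow. -/
lemma IsWRT.finite_range (hK : IsWRT μ w K) {n : ℕ} {f : Ω → ℝ}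
    (hf : Measurable[treeSigma K n] f) : (Set.range f).Finite := by
  let g : Ω → (Set.Icc 2 n → ℕ) := fun ω m => K m ω
  have hle : treeSigma K n ≤ MeasurableSpace.comap g ⊤ := by
    refine iSup₂_le fun m hm => ?_
    rintro s ⟨t, -, rfl⟩
    exact ⟨{v | v ⟨m, hm⟩ ∈ t}, trivial, rfl⟩
  have hfib : ∀ ω ω', g ω = g ω' → f ω = f ω' := by
    intro ω ω' h
    obtain ⟨t, -, ht⟩ := hle _ (hf (measurableSet_singleton (f ω')))
    have : ω' ∈ g ⁻¹' t := by rw [ht]; rfl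
    have h2 : ω ∈ g ⁻¹' t := by
      rw [Set.mem_preimage, h]; exact this
    rw [ht] at h2
    exact h2
  have hfin : (Set.range g).Finite := by
    refine (Set.Finite.pi (t := fun _ : Set.Icc 2 n => Set.Iic n) fun _ => Set.finite_Iic n).subset ?_
    rintro _ ⟨ω, rfl⟩ ⟨m, hm⟩ -
    have := ((hK.isParentMap ω).mem hm.1).2
    exact (this.le.trans hm.2 : K m ω ≤ n)
  classical
  by_cases hne : Nonempty Ω
  · refine (hfin.image (fun v => f (Function.invFun g v))).subset ?_
    rintro _ ⟨ω, rfl⟩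
    exact ⟨g ω, ⟨ω, rfl⟩, hfib _ _ (Function.invFun_eq ⟨ω, rfl⟩)⟩
  · rw [not_nonempty_iff] at hne
    rw [Set.range_eq_empty]
    exact Set.finite_empty

lemma IsWRT.comp_parent_eq_sum (hK : IsWRT μ w K) {n : ℕ} (hn : 1 ≤ n) (F : ℕ → Ω → ℝ) (ω : Ω) :
    F (K (n + 1) ω) ω =
      ∑ k ∈ Finset.Icc 1 n, F k ω * (K (n + 1) ⁻¹' {k}).indicator (fun _ => (1 : ℝ)) ω := by
  have hmem := hK.parent_mem n hn ω
  rw [Finset.sum_eq_single (K (n + 1) ω)]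
  · simp
  · intro k _ hk
    rw [Set.indicator_of_notMem (by simpa using hk.symm), mul_zero]
  · intro h
    exact absurd (Finset.mem_Icc.2 hmem) h

lemma IsWRT.measurable_comp_parent (hK : IsWRT μ w K) {n : ℕ} (hn : 1 ≤ n) {F : ℕ → Ω → ℝ}
    (hF : ∀ k ∈ Finset.Icc 1 n, Measurable[treeSigma K n] (F k)) :
    Measurable[treeSigma K (n + 1)] (fun ω => F (K (n + 1) ω) ω) := by
  rw [funext (hK.comp_parent_eq_sum hn F)]
  refine Finset.measurable_fun_sum _ fun k hk => ?_
  refine ((hF k hk).mono (treeSigma_mono K (by omega)) le_rfl).mul ?_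
  exact Measurable.indicator measurable_const
    (measurable_parent_treeSigma K (by omega) le_rfl (measurableSet_singleton k))

lemma IsWRT.measurable_pathSum (hK : IsWRT μ w K) (f : ℕ → ℝ) {m n : ℕ} (hm : 1 ≤ m)
    (hmn : m ≤ n) : Measurable[treeSigma K n] (fun ω => pathSum f (fun i => K i ω) m) := by
  suffices H : Measurable[treeSigma K m] (fun ω => pathSum f (fun i => K i ω) m) from
    H.mono (treeSigma_mono K hmn) le_rfl
  clear hmn
  induction m using Nat.strong_induction_on with
  | _ m ih =>
    rcases hm.eq_or_lt with rfl | h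
    · simp only [pathSum_one]
      exact measurable_const
    · obtain ⟨k, rfl⟩ : ∃ k, m = k + 1 := ⟨m - 1, by omega⟩
      have h1 : (fun ω => pathSum f (fun i => K i ω) (k + 1)) =
          fun ω => f (k + 1) + pathSum f (fun i => K i ω) (K (k + 1) ω) :=
        funext fun ω => (hK.isParentMap ω).pathSum_eq f h
      rw [h1]
      refine Measurable.const_add (hK.measurable_comp_parent (n := k) (by omega)
        (F := fun j ω => pathSum f (fun i => K i ω) j) fun j hj => ?_) _
      rw [Finset.mem_Icc] at hj
      exact (ih j (by omega) hj.1).mono (treeSigma_mono K hj.2) le_rfl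

lemma cast_vertexHeight_eq_pathSum (par : ℕ → ℕ) (m : ℕ) :
    (vertexHeight par m : ℝ) = pathSum (fun _ => 1) par m := by
  simp [pathSum]

lemma IsWRT.measurableSet_le_vertexHeight (hK : IsWRT μ w K) (h : ℕ) {m n : ℕ} (hm : 1 ≤ m)
    (hmn : m ≤ n) : MeasurableSet[treeSigma K n] {ω | h ≤ vertexHeight (fun i => K i ω) m} := by
  have : {ω | h ≤ vertexHeight (fun i => K i ω) m} =
      (fun ω => pathSum (fun _ => 1) (fun i => K i ω) m) ⁻¹' Set.Ici (h : ℝ) := by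
    ext ω
    simp [← cast_vertexHeight_eq_pathSum]
  rw [this]
  exact hK.measurable_pathSum _ hm hmn measurableSet_Ici

variable [IsProbabilityMeasure μ]

lemma IsWRT.integrable (hK : IsWRT μ w K) {n : ℕ} {f : Ω → ℝ}
    (hf : Measurable[treeSigma K n] f) : Integrable f μ := by
  obtain ⟨C, hC⟩ := (hK.finite_range hf).isBounded.exists_norm_le
  exact Integrable.of_bound (hf.mono (hK.treeSigma_le n) le_rfl).aestronglyMeasurable C
    (Eventually.of_forall fun ω => hC _ ⟨ω, rfl⟩)

/-- Averaging over the parent of the vertex `n + 1`, given `T_n`. -/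
lemma IsWRT.integral_comp_parent (hK : IsWRT μ w K) {n : ℕ} (hn : 1 ≤ n) {F : ℕ → Ω → ℝ}
    (hF : ∀ k ∈ Finset.Icc 1 n, Measurable[treeSigma K n] (F k)) :
    ∫ ω, F (K (n + 1) ω) ω ∂μ = ∑ k ∈ Finset.Icc 1 n, w k / totalWeight w n * ∫ ω, F k ω ∂μ := by
  have hle := hK.treeSigma_le n
  have hKm := hK.measurable_parent n hn
  have hmeas : ∀ k, MeasurableSet (K (n + 1) ⁻¹' {k}) := fun k => hKm (measurableSet_singleton k)
  have hint1 : ∀ k, Integrable ((K (n + 1) ⁻¹' {k}).indicator (fun _ => (1 : ℝ))) μ := fun k =>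
    (integrable_const 1).indicator (hmeas k)
  have hint : ∀ k ∈ Finset.Icc 1 n, Integrable
      (F k * (K (n + 1) ⁻¹' {k}).indicator (fun _ => (1 : ℝ))) μ := fun k hk => by
    obtain ⟨C, hC⟩ := (hK.finite_range (hF k hk)).isBounded.exists_norm_le
    exact (hint1 k).bdd_mul ((hF k hk).mono hle le_rfl).aestronglyMeasurable
      (Eventually.of_forall fun ω => hC _ ⟨ω, rfl⟩)
  refine (integral_congr_ae (Eventually.of_forall (hK.comp_parent_eq_sum hn F))).trans
    ((integral_finsetSum _ hint).trans ?_)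
  refine Finset.sum_congr rfl fun k hk => ?_
  have h1 := condExp_mul_of_stronglyMeasurable_left (m := treeSigma K n) (μ := μ)
    (hF k hk).stronglyMeasurable (hint k hk) (hint1 k)
  rw [← integral_const_mul]
  have h2 := integral_condExp (μ := μ) hle
    (f := F k * (K (n + 1) ⁻¹' {k}).indicator (fun _ => (1 : ℝ)))
  refine h2.symm.trans (integral_congr_ae ?_)
  filter_upwards [h1, hK.condProb_parent n hn k (Finset.mem_Icc.1 hk)] with ω h3 h4
  rw [h3, Pi.mul_apply, h4, mul_comm]

/-- Exponential moment of the sum of `f` along the path from `n + 1` to the root. -/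
lemma IsWRT.integral_exp_pathSum_le (hK : IsWRT μ w K) (hw : ∀ i, 1 ≤ i → 0 ≤ w i)
    (hw1 : 0 < w 1) (f : ℕ → ℝ) {n : ℕ} (hn : 1 ≤ n) :
    ∫ ω, Real.exp (pathSum f (fun i => K i ω) (n + 1)) ∂μ ≤
      Real.exp (f (n + 1) + ∑ i ∈ Finset.Icc 2 n, (Real.exp (f i) - 1) * (w i / totalWeight w i)) := by
  set y : ℕ → ℝ := fun m => ∫ ω, Real.exp (pathSum f (fun i => K i ω) m) ∂μ with hy
  have hy1 : y 1 = 1 := by simp [hy]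
  have hrec : ∀ n, 1 ≤ n → y (n + 1) =
      Real.exp (f (n + 1)) * ((∑ k ∈ Finset.Icc 1 n, w k * y k) / totalWeight w n) := by
    intro n hn
    have h1 : y (n + 1) = ∫ ω, Real.exp (f (n + 1)) *
        Real.exp (pathSum f (fun i => K i ω) (K (n + 1) ω)) ∂μ := by
      refine integral_congr_ae (Eventually.of_forall fun ω => ?_)
      simp only
      rw [(hK.isParentMap ω).pathSum_eq f (by omega), Real.exp_add]
    rw [h1, integral_const_mul, hK.integral_comp_parent hn
      (F := fun k ω => Real.exp (pathSum f (fun i => K i ω) k)), Finset.sum_div]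
    · congr 1
      refine Finset.sum_congr rfl fun k _ => ?_
      ring
    · intro k hk
      rw [Finset.mem_Icc] at hk
      exact Real.measurable_exp.comp (hK.measurable_pathSum f hk.1 hk.2)
  -- Adding the vertex n + 1 multiplies the weighted average of the moments by exactly 1 +
  -- (e^{f(n+1)} - 1) w_{n+1}/W_{n+1}, and 1 + t ≤ e^t.
  have key : ∀ n, 1 ≤ n → (∑ k ∈ Finset.Icc 1 n, w k * y k) / totalWeight w n ≤
      Real.exp (∑ i ∈ Finset.Icc 2 n, (Real.exp (f i) - 1) * (w i / totalWeight w i)) := by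
    intro n hn
    induction n, hn using Nat.le_induction with
    | base => simp [totalWeight, hy1, hw1.ne']
    | succ n hn ih =>
      have hW := totalWeight_pos hw hw1 hn
      have hW' := totalWeight_pos hw hw1 (show 1 ≤ n + 1 by omega)
      have hsucc := totalWeight_succ w n
      rw [Finset.sum_Icc_succ_top (by omega), Finset.sum_Icc_succ_top (by omega), hrec n hn,
        Real.exp_add]
      set σ := ∑ k ∈ Finset.Icc 1 n, w k * y k with hσ
      have h2 : (σ + w (n + 1) * (Real.exp (f (n + 1)) * (σ / totalWeight w n))) /
          totalWeight w (n + 1) = σ / totalWeight w n *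
          ((Real.exp (f (n + 1)) - 1) * (w (n + 1) / totalWeight w (n + 1)) + 1) := by
        have h3 : w (n + 1) = totalWeight w (n + 1) - totalWeight w n := by linarith
        rw [h3]
        field_simp
        ring
      rw [h2]
      refine mul_le_mul ih (Real.add_one_le_exp _) ?_ (Real.exp_pos _).le
      have h4 : w (n + 1) / totalWeight w (n + 1) ≤ 1 := by
        rw [div_le_one hW']; linarith
      have h5 : 0 ≤ w (n + 1) / totalWeight w (n + 1) := div_nonneg (hw _ (by omega)) hW'.le
      nlinarith [Real.exp_pos (f (n + 1))]
  change y (n + 1) ≤ _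
  rw [hrec n hn, Real.exp_add]
  exact mul_le_mul_of_nonneg_left (key n hn) (Real.exp_pos _).le

end Probability

/-! ### Second moment of the weight attached to high vertices -/

/-- Total weight of the vertices of `T_n` of height at least `h`. -/
def heavyWeight (w : ℕ → ℝ) (par : ℕ → ℕ) (n h : ℕ) : ℝ :=
  ∑ i ∈ Finset.Icc 1 n, if h ≤ vertexHeight par i then w i else 0

section HeavyWeight

variable {w : ℕ → ℝ} {par : ℕ → ℕ}

lemma heavyWeight_nonneg (hw : ∀ i, 1 ≤ i → 0 ≤ w i) (n h : ℕ) : 0 ≤ heavyWeight w par n h :=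
  Finset.sum_nonneg fun i hi => by
    split_ifs
    · exact hw i (Finset.mem_Icc.1 hi).1
    · exact le_rfl

lemma heavyWeight_mono (hw : ∀ i, 1 ≤ i → 0 ≤ w i) {n N : ℕ} (h : ℕ) (hnN : n ≤ N) :
    heavyWeight w par n h ≤ heavyWeight w par N h :=
  Finset.sum_le_sum_of_subset_of_nonneg (Finset.Icc_subset_Icc le_rfl hnN) fun i hi _ => by
    split_ifs
    · exact hw i (Finset.mem_Icc.1 hi).1
    · exact le_rfl

lemma heavyWeight_zero (w : ℕ → ℝ) (par : ℕ → ℕ) (n : ℕ) :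
    heavyWeight w par n 0 = totalWeight w n := by
  simp [heavyWeight, totalWeight]

lemma le_treeHeight_of_heavyWeight_pos {n h : ℕ} (hpos : 0 < heavyWeight w par n h) :
    h ≤ treeHeight par n := by
  obtain ⟨i, hi, hne⟩ := Finset.exists_ne_zero_of_sum_ne_zero hpos.ne'
  have hle : h ≤ vertexHeight par i := by
    by_contra hcon
    simp [hcon] at hne
  exact hle.trans (Finset.le_sup hi)

/-- The indicator that `k` is a vertex of `T_n` of height at least `h`. -/
def tallIndicator (par : ℕ → ℕ) (n h k : ℕ) : ℝ :=
  if k ≤ n ∧ h ≤ vertexHeight par k then 1 else 0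

lemma tallIndicator_sq (par : ℕ → ℕ) (n h k : ℕ) :
    tallIndicator par n h k ^ 2 = tallIndicator par n h k := by
  unfold tallIndicator; split_ifs <;> simp

lemma sum_mul_tallIndicator (w : ℕ → ℝ) (par : ℕ → ℕ) {n N : ℕ} (h : ℕ) (hnN : n ≤ N) :
    ∑ k ∈ Finset.Icc 1 N, w k * tallIndicator par n h k = heavyWeight w par n h := by
  have h1 := Finset.sum_subset (Finset.Icc_subset_Icc (le_refl 1) hnN)
    (f := fun k => w k * tallIndicator par n h k) (fun k hk hk' => by
      rw [Finset.mem_Icc] at hk hk'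
      have : ¬ k ≤ n := fun h => hk' ⟨hk.1, h⟩
      simp [tallIndicator, this])
  rw [← h1]
  refine Finset.sum_congr rfl fun k hk => ?_
  rw [Finset.mem_Icc] at hk
  simp [tallIndicator, hk.2]

lemma IsParentMap.heavyWeight_add_le (hp : IsParentMap par) (hw : ∀ i, 1 ≤ i → 0 ≤ w i) {n N : ℕ}
    (hn : 1 ≤ n) (h : ℕ) (hnN : n ≤ N) :
    heavyWeight w par n (h + 1) + ∑ i ∈ Finset.Ioc n N, w i * tallIndicator par n h (par i) ≤
      heavyWeight w par N (h + 1) := by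
  have hsplit : Finset.Icc 1 N = Finset.Icc 1 n ∪ Finset.Ioc n N := by
    ext i; simp only [Finset.mem_Icc, Finset.mem_union, Finset.mem_Ioc]; omega
  have hdisj : Disjoint (Finset.Icc 1 n) (Finset.Ioc n N) := by
    rw [Finset.disjoint_left]; intro i; simp only [Finset.mem_Icc, Finset.mem_Ioc]; omega
  rw [heavyWeight, heavyWeight, hsplit, Finset.sum_union hdisj]
  gcongr with i hi
  rw [Finset.mem_Ioc] at hi
  have hi2 : 2 ≤ i := by omega
  rw [hp.vertexHeight_eq hi2, tallIndicator]
  by_cases hc : h ≤ vertexHeight par (par i)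
  · rw [if_pos (Nat.succ_le_succ hc)]
    split_ifs
    · simp
    · simpa using hw i (by omega)
  · rw [if_neg (by tauto), mul_zero, if_neg (by omega)]

end HeavyWeight

section Probability

variable {Ω : Type*} [MeasurableSpace Ω] {μ : Measure Ω} {w : ℕ → ℝ} {K : ℕ → Ω → ℕ}

lemma IsWRT.measurable_heavyWeight (hK : IsWRT μ w K) (n h : ℕ) :
    Measurable[treeSigma K n] (fun ω => heavyWeight w (fun i => K i ω) n h) := by
  refine Finset.measurable_fun_sum _ fun i hi => ?_
  rw [Finset.mem_Icc] at hi
  exact Measurable.ite (hK.measurableSet_le_vertexHeight h hi.1 hi.2) measurable_const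
    measurable_const

lemma IsWRT.measurable_tallIndicator (hK : IsWRT μ w K) (n h : ℕ) {k : ℕ} (hk : 1 ≤ k) :
    Measurable[treeSigma K n] (fun ω => tallIndicator (fun i => K i ω) n h k) := by
  unfold tallIndicator
  by_cases hkn : k ≤ n
  · simp only [hkn, true_and]
    exact Measurable.ite (hK.measurableSet_le_vertexHeight h hk hkn) measurable_const
      measurable_const
  · simp only [hkn, false_and, if_false]
    exact measurable_const

/-- The deviation of the weight of the vertices with labels in `(n, N]` attached to vertices of
`T_n` of height at least `h`, from its conditional mean given `T_n`. -/
def deviation (w : ℕ → ℝ) (par : ℕ → ℕ) (n h N : ℕ) : ℝ :=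
  ∑ i ∈ Finset.Ioc n N, w i *
    (tallIndicator par n h (par i) - heavyWeight w par n h / totalWeight w (i - 1))

lemma deviation_succ (w : ℕ → ℝ) (par : ℕ → ℕ) {n N : ℕ} (h : ℕ) (hnN : n ≤ N) :
    deviation w par n h (N + 1) = deviation w par n h N + w (N + 1) *
      (tallIndicator par n h (par (N + 1)) - heavyWeight w par n h / totalWeight w N) := by
  rw [deviation, ← Finset.insert_Ioc_right_eq_Ioc_add_one hnN, Finset.sum_insert (by simp),
    add_comm]
  rfl

lemma IsWRT.measurable_deviation (hK : IsWRT μ w K) {n N : ℕ} (hn : 1 ≤ n) (h : ℕ) (hnN : n ≤ N) :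
    Measurable[treeSigma K N] (fun ω => deviation w (fun i => K i ω) n h N) := by
  induction N, hnN using Nat.le_induction with
  | base =>
    simp only [deviation, Finset.Ioc_self, Finset.sum_empty]
    exact measurable_const
  | succ N hnN ih =>
    simp only [deviation_succ w _ h hnN]
    refine (ih.mono (treeSigma_mono K (by omega)) le_rfl).add (Measurable.const_mul ?_ _)
    refine Measurable.sub ?_ (Measurable.div_const ?_ _)
    · exact hK.measurable_comp_parent (n := N) (by omega)
        (F := fun k ω => tallIndicator (fun i => K i ω) n h k) fun k hk =>
          (hK.measurable_tallIndicator n h (Finset.mem_Icc.1 hk).1).mono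
            (treeSigma_mono K hnN) le_rfl
    · exact (hK.measurable_heavyWeight n h).mono (treeSigma_mono K (by omega)) le_rfl

/-- One martingale step: under the law w_k / W_N the 0–1 valued c is a Bernoulli variable with mean
φ = ψ / W_N. The cross term vanishes and the variance is φ - φ². -/
lemma sum_weight_mul_sq (w c : ℕ → ℝ) (N : ℕ) (hW : totalWeight w N ≠ 0)
    (hc : ∀ k, c k ^ 2 = c k) (M v ψ : ℝ) (hψ : ∑ k ∈ Finset.Icc 1 N, w k * c k = ψ) :
    ∑ k ∈ Finset.Icc 1 N, w k / totalWeight w N * (M + v * (c k - ψ / totalWeight w N)) ^ 2 =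
      M ^ 2 + v ^ 2 * (ψ / totalWeight w N - (ψ / totalWeight w N) ^ 2) := by
  set φ := ψ / totalWeight w N with hφ
  have h1 : ∀ k, w k / totalWeight w N * (M + v * (c k - φ)) ^ 2 =
      (w k * (M - v * φ) ^ 2 + (w k * c k) * (v ^ 2 + 2 * v * (M - v * φ))) / totalWeight w N := by
    intro k
    rw [div_mul_eq_mul_div]
    congr 1
    linear_combination w k * v ^ 2 * hc k
  simp only [h1]
  rw [← Finset.sum_div, Finset.sum_add_distrib, ← Finset.sum_mul, ← Finset.sum_mul, hψ]
  have h2 : ψ = φ * totalWeight w N := by rw [hφ]; field_simp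
  change (totalWeight w N * _ + _) / _ = _
  rw [h2]
  field_simp
  ring

variable [IsProbabilityMeasure μ]

/-- Given T_n the deviation is a martingale in N, so its increments are orthogonal, and the step at
i has conditional variance at most w_i² / W_{i-1} times the heavy weight. The factor X, known at
time n, keeps the bound conditional on T_n. -/
lemma IsWRT.integral_mul_deviation_sq_le (hK : IsWRT μ w K) (hw : ∀ i, 1 ≤ i → 0 ≤ w i)
    (hw1 : 0 < w 1) {n N : ℕ} (hn : 1 ≤ n) (h : ℕ) (hnN : n ≤ N) {X : Ω → ℝ}
    (hX : Measurable[treeSigma K n] X) (hX0 : ∀ ω, 0 ≤ X ω) :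
    ∫ ω, X ω * deviation w (fun i => K i ω) n h N ^ 2 ∂μ ≤
      (∑ i ∈ Finset.Ioc n N, w i ^ 2 / totalWeight w (i - 1)) *
        ∫ ω, X ω * heavyWeight w (fun i => K i ω) n h ∂μ := by
  have hmono : ∀ {m : ℕ} {f : Ω → ℝ}, n ≤ m → Measurable[treeSigma K n] f →
      Measurable[treeSigma K m] f := fun hm hf => hf.mono (treeSigma_mono K hm) le_rfl
  induction N, hnN using Nat.le_induction with
  | base => simp [deviation]
  | succ N hnN ih =>
    have hW := totalWeight_pos hw hw1 (hn.trans hnN)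
    have hXN := hmono hnN hX
    have hdev := hK.measurable_deviation hn h hnN
    have hheavy := hmono hnN (hK.measurable_heavyWeight n h)
    set F : ℕ → Ω → ℝ := fun k ω => X ω * (deviation w (fun i => K i ω) n h N + w (N + 1) *
      (tallIndicator (fun i => K i ω) n h k -
        heavyWeight w (fun i => K i ω) n h / totalWeight w N)) ^ 2 with hF
    have hFm : ∀ k ∈ Finset.Icc 1 N, Measurable[treeSigma K N] (F k) := fun k hk =>
      hXN.mul (((hdev.add (((hmono hnN (hK.measurable_tallIndicator n h
        (Finset.mem_Icc.1 hk).1)).sub (hheavy.div_const _)).const_mul _))).pow_const 2)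
    have h1 : ∫ ω, X ω * deviation w (fun i => K i ω) n h (N + 1) ^ 2 ∂μ =
        ∫ ω, F (K (N + 1) ω) ω ∂μ := by
      simp only [deviation_succ w _ h hnN, hF]
    have h2 : ∀ ω, ∑ k ∈ Finset.Icc 1 N, w k / totalWeight w N * F k ω ≤
        X ω * deviation w (fun i => K i ω) n h N ^ 2 + w (N + 1) ^ 2 / totalWeight w N *
          (X ω * heavyWeight w (fun i => K i ω) n h) := by
      intro ω
      have h3 := sum_weight_mul_sq w (tallIndicator (fun i => K i ω) n h) N hW.ne'
        (tallIndicator_sq _ n h) (deviation w (fun i => K i ω) n h N) (w (N + 1)) _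
        (sum_mul_tallIndicator w (fun i => K i ω) h hnN)
      have h4 : ∑ k ∈ Finset.Icc 1 N, w k / totalWeight w N * F k ω = X ω *
          (deviation w (fun i => K i ω) n h N ^ 2 + w (N + 1) ^ 2 *
            (heavyWeight w (fun i => K i ω) n h / totalWeight w N -
              (heavyWeight w (fun i => K i ω) n h / totalWeight w N) ^ 2)) := by
        rw [← h3, Finset.mul_sum]
        refine Finset.sum_congr rfl fun k _ => ?_
        simp only [hF]; ring
      rw [h4]
      have h5 : 0 ≤ X ω * (w (N + 1) ^ 2 *
          (heavyWeight w (fun i => K i ω) n h / totalWeight w N) ^ 2) :=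
        mul_nonneg (hX0 ω) (by positivity)
      calc _ = X ω * deviation w (fun i => K i ω) n h N ^ 2 + w (N + 1) ^ 2 / totalWeight w N *
          (X ω * heavyWeight w (fun i => K i ω) n h) - X ω * (w (N + 1) ^ 2 *
          (heavyWeight w (fun i => K i ω) n h / totalWeight w N) ^ 2) := by ring
        _ ≤ _ := by linarith
    have hint1 := hK.integrable (hXN.mul (hdev.pow_const 2))
    have hint2 := (hK.integrable (hXN.mul hheavy)).const_mul (w (N + 1) ^ 2 / totalWeight w N)
    rw [h1, hK.integral_comp_parent (hn.trans hnN) hFm]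
    simp only [← integral_const_mul]
    rw [← integral_finsetSum _ fun k hk => (hK.integrable (hFm k hk)).const_mul _]
    refine (integral_mono (integrable_finsetSum _ fun k hk =>
      (hK.integrable (hFm k hk)).const_mul _) (hint1.add hint2) h2).trans ?_
    have h6 := integral_add hint1 hint2
    refine h6.le.trans ?_
    rw [integral_const_mul, integral_const_mul, ← Finset.insert_Ioc_right_eq_Ioc_add_one hnN,
      Finset.sum_insert (by simp), add_mul, Nat.add_sub_cancel, add_comm]
    exact add_le_add le_rfl ih

/-- The probability that the weight at height at least `h + 1` fails to grow as expected between
times `n` and `N`. -/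
lemma IsWRT.measureReal_heavyWeight_lt_le (hK : IsWRT μ w K) (hw : ∀ i, 1 ≤ i → 0 ≤ w i)
    (hw1 : 0 < w 1) {n N : ℕ} (hn : 1 ≤ n) (h : ℕ) (hnN : n ≤ N) {θ ε : ℝ} (hθ : 0 < θ)
    (hε : 0 < ε) (hb : 0 < aSeq w N - aSeq w n) :
    μ.real {ω | θ ≤ heavyWeight w (fun i => K i ω) n h ∧
      heavyWeight w (fun i => K i ω) N (h + 1) < heavyWeight w (fun i => K i ω) n (h + 1) +
        (1 - ε) * (aSeq w N - aSeq w n) * heavyWeight w (fun i => K i ω) n h} ≤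
      (∑ i ∈ Finset.Ioc n N, w i ^ 2 / totalWeight w (i - 1)) /
        (θ * (ε * (aSeq w N - aSeq w n)) ^ 2) := by
  set b := aSeq w N - aSeq w n with hbdef
  set Ψ : Ω → ℝ := fun ω => heavyWeight w (fun i => K i ω) n h with hΨ
  have hΨm : Measurable[treeSigma K n] Ψ := hK.measurable_heavyWeight n h
  -- Normalising by Ψ² on {Ψ ≥ θ} gives Chebyshev's inequality relative to the random size Ψ; the
  -- variance bound then involves only the mean of XΨ, which is at most 1/θ.
  set X : Ω → ℝ := fun ω => if θ ≤ Ψ ω then (Ψ ω ^ 2)⁻¹ else 0 with hXdef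
  have hX : Measurable[treeSigma K n] X :=
    Measurable.ite (hΨm measurableSet_Ici) (hΨm.pow_const 2).inv measurable_const
  have hX0 : ∀ ω, 0 ≤ X ω := fun ω => by
    simp only [hXdef]; split_ifs <;> positivity
  have hXN : Measurable[treeSigma K N] X := hX.mono (treeSigma_mono K hnN) le_rfl
  have hint := hK.integrable (hXN.mul ((hK.measurable_deviation hn h hnN).pow_const 2))
  have hV0 : 0 ≤ ∑ i ∈ Finset.Ioc n N, w i ^ 2 / totalWeight w (i - 1) :=
    Finset.sum_nonneg fun i hi => div_nonneg (sq_nonneg _)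
      (totalWeight_pos hw hw1 (by have := Finset.mem_Ioc.1 hi; omega)).le
  have h1 := mul_meas_ge_le_integral_of_nonneg
    (Eventually.of_forall fun ω => mul_nonneg (hX0 ω) (sq_nonneg _)) hint ((ε * b) ^ 2)
  have h2 := hK.integral_mul_deviation_sq_le hw hw1 hn h hnN hX hX0
  have h3 : ∫ ω, X ω * Ψ ω ∂μ ≤ 1 / θ := by
    have : ∀ ω, X ω * Ψ ω ≤ 1 / θ := by
      intro ω
      simp only [hXdef]
      split_ifs with hc
      · have hpos : 0 < Ψ ω := hθ.trans_le hc
        rw [inv_mul_eq_div, pow_two, div_mul_cancel_left₀ hpos.ne', ← one_div]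
        exact one_div_le_one_div_of_le hθ hc
      · rw [zero_mul]; positivity
    have h4 := integral_mono (hK.integrable (hX.mul hΨm)) (integrable_const (1 / θ)) this
    simpa using h4
  -- The mean growth rate has denominators W_{i-1} ≤ W_i, so replacing it by b only weakens the
  -- lower bound.
  have hsum : b ≤ ∑ i ∈ Finset.Ioc n N, w i / totalWeight w (i - 1) := by
    have h5 : b = ∑ i ∈ Finset.Ioc n N, w i / totalWeight w i := by
      have hsplit : Finset.Icc 1 N = Finset.Icc 1 n ∪ Finset.Ioc n N := by
        ext i; simp only [Finset.mem_Icc, Finset.mem_union, Finset.mem_Ioc]; omega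
      have hdisj : Disjoint (Finset.Icc 1 n) (Finset.Ioc n N) := by
        rw [Finset.disjoint_left]; intro i; simp only [Finset.mem_Icc, Finset.mem_Ioc]; omega
      rw [hbdef, aSeq, aSeq, hsplit, Finset.sum_union hdisj]
      ring
    rw [h5]
    refine Finset.sum_le_sum fun i hi => ?_
    have hi' := Finset.mem_Ioc.1 hi
    exact div_le_div_of_nonneg_left (hw i (by omega)) (totalWeight_pos hw hw1 (by omega))
      (totalWeight_mono hw (by omega))
  have hsub : {ω | θ ≤ Ψ ω ∧ heavyWeight w (fun i => K i ω) N (h + 1) <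
      heavyWeight w (fun i => K i ω) n (h + 1) + (1 - ε) * b * Ψ ω} ⊆
      {ω | (ε * b) ^ 2 ≤ (X * fun ω => deviation w (fun i => K i ω) n h N ^ 2) ω} := by
    rintro ω ⟨ha, hlt⟩
    have hpos : 0 < Ψ ω := hθ.trans_le ha
    have h6 := (hK.isParentMap ω).heavyWeight_add_le hw hn h hnN
    have h7 : deviation w (fun i => K i ω) n h N =
        ∑ i ∈ Finset.Ioc n N, w i * tallIndicator (fun i => K i ω) n h (K i ω) -
          Ψ ω * ∑ i ∈ Finset.Ioc n N, w i / totalWeight w (i - 1) := by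
      rw [deviation, Finset.mul_sum, ← Finset.sum_sub_distrib]
      refine Finset.sum_congr rfl fun i _ => ?_
      ring
    have h8 := mul_le_mul_of_nonneg_left hsum hpos.le
    have h9 : ε * b * Ψ ω ≤ -deviation w (fun i => K i ω) n h N := by
      rw [h7]; linarith
    have h10 := pow_le_pow_left₀ (by positivity) h9 2
    simp only [Set.mem_ofPred_eq, Pi.mul_apply, hXdef, if_pos ha]
    rw [inv_mul_eq_div, le_div_iff₀ (by positivity)]
    calc (ε * b) ^ 2 * Ψ ω ^ 2 = (ε * b * Ψ ω) ^ 2 := by ring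
      _ ≤ _ := h10
      _ = _ := by ring
  have h11 := measureReal_mono (μ := μ) hsub
  have hsq : 0 < (ε * b) ^ 2 := by positivity
  rw [le_div_iff₀ (by positivity)]
  have h12 := (h1.trans h2).trans (mul_le_mul_of_nonneg_left h3 hV0)
  have h13 := mul_le_mul_of_nonneg_left h11 hsq.le
  have h14 := h13.trans h12
  rw [mul_one_div, le_div_iff₀ hθ] at h14
  linarith

end Probability

end Recursion

/-! ### Exponential windows and their masses -/

/-- The function `E` with `x^{-α} L(x) = e^{-E(x)}`. -/
def logDensity (α : ℝ) (L : ℝ → ℝ) (x : ℝ) : ℝ := α * Real.log x - Real.log (L x)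

/-- The least integer that is at least `e^j`. -/
def expLabel (j : ℕ) : ℕ := ⌈Real.exp j⌉₊

section ExpLabel

lemma exp_le_expLabel (j : ℕ) : Real.exp j ≤ expLabel j := Nat.le_ceil _

lemma one_le_expLabel (j : ℕ) : 1 ≤ expLabel j := Nat.one_le_ceil_iff.2 (Real.exp_pos _)

lemma expLabel_mono : Monotone expLabel := fun i j h =>
  Nat.ceil_le_ceil (Real.exp_le_exp.2 (by exact_mod_cast h))

lemma le_log_expLabel (j : ℕ) : (j : ℝ) ≤ Real.log (expLabel j) := by
  rw [Real.le_log_iff_exp_le (by exact_mod_cast one_le_expLabel j)]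
  exact exp_le_expLabel j

lemma log_expLabel_le (j : ℕ) : Real.log (expLabel j) ≤ j + Real.exp (-j) := by
  have h1 : (expLabel j : ℝ) ≤ Real.exp j * Real.exp (Real.exp (-j)) := by
    have h2 : (expLabel j : ℝ) ≤ Real.exp j + 1 := (Nat.ceil_lt_add_one (Real.exp_pos _).le).le
    have h3 := Real.add_one_le_exp (Real.exp (-j))
    have h4 : Real.exp j * Real.exp (-j) = 1 := by rw [← Real.exp_add]; simp
    nlinarith [Real.exp_pos (j : ℝ)]
  rw [← Real.exp_add] at h1
  exact (Real.log_le_iff_le_exp (by exact_mod_cast one_le_expLabel j)).2 h1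

lemma tendsto_log_expLabel_sub : Tendsto (fun j : ℕ => Real.log (expLabel j) - j) atTop (𝓝 0) := by
  have h : Tendsto (fun j : ℕ => Real.exp (-(j : ℝ))) atTop (𝓝 0) :=
    Real.tendsto_exp_neg_atTop_nhds_zero.comp tendsto_natCast_atTop_atTop
  refine tendsto_of_tendsto_of_tendsto_of_le_of_le tendsto_const_nhds h
    (fun j => sub_nonneg.2 (le_log_expLabel j)) (fun j => ?_)
  have := log_expLabel_le j
  simp only
  linarith

lemma log_expLabel_le_add_one (j : ℕ) : Real.log (expLabel j) ≤ j + 1 := by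
  have h1 := log_expLabel_le j
  have h2 : Real.exp (-(j : ℝ)) ≤ 1 := Real.exp_le_one_iff.2 (by simp)
  linarith

lemma tendsto_expLabel : Tendsto expLabel atTop atTop := by
  refine tendsto_atTop_mono (fun j => ?_) tendsto_id
  have h1 := exp_le_expLabel j
  have h2 := Real.add_one_le_exp (j : ℝ)
  have h3 : (j : ℝ) ≤ expLabel j := by linarith
  exact_mod_cast h3

lemma expLabel_floor_log_le {n : ℕ} (hn : 1 ≤ n) : expLabel ⌊Real.log n⌋₊ ≤ n := by
  have hn0 : (0 : ℝ) < n := by exact_mod_cast hn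
  refine Nat.ceil_le.2 ?_
  rw [← Real.le_log_iff_exp_le hn0]
  exact Nat.floor_le (Real.log_nonneg (by exact_mod_cast hn))

lemma le_expLabel_floor_log {n : ℕ} (hn : 1 ≤ n) : n ≤ expLabel (⌊Real.log n⌋₊ + 1) := by
  have hn0 : (0 : ℝ) < n := by exact_mod_cast hn
  have h1 := (Real.log_le_iff_le_exp hn0).1 (Nat.lt_floor_add_one (Real.log n)).le
  have h2 := exp_le_expLabel (⌊Real.log n⌋₊ + 1)
  push_cast at h2
  exact_mod_cast h1.trans h2

end ExpLabel

section Density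

variable {α : ℝ} {L : ℝ → ℝ}

lemma logLike_logDensity (hL_pos : ∀ x, 1 ≤ x → 0 < L x) (hL : SV 2 L) :
    LogLike α (logDensity α L) := by
  have hd : ∀ t : ℝ, 1 < t → DifferentiableAt ℝ L t := fun t ht => by
    have := hL.1 0 (by norm_num)
    rw [iteratedDerivWithin_zero] at this
    exact (this t ht.le).differentiableAt (Ici_mem_nhds ht)
  have hlog : LogLike 0 (fun x => Real.log (L x)) := by
    refine ⟨?_, ?_⟩
    · filter_upwards [eventually_gt_atTop 1] with t ht using (hd t ht).log (hL_pos t ht.le).ne'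
    · refine (hL.2 1 ⟨le_rfl, by norm_num⟩).congr' ?_
      filter_upwards [eventually_gt_atTop 1] with t ht
      rw [iteratedDerivWithin_one, derivWithin_of_mem_nhds (Ici_mem_nhds ht), pow_one,
        deriv.log (hd t ht) (hL_pos t ht.le).ne', mul_div_assoc]
  have := (logLike_mul_log α).sub hlog
  rwa [sub_zero] at this

lemma exp_neg_logDensity (hL_pos : ∀ x, 1 ≤ x → 0 < L x) {x : ℝ} (hx : 1 ≤ x) :
    Real.exp (-logDensity α L x) = x ^ (-α) * L x := by
  rw [logDensity, neg_sub, sub_eq_add_neg, Real.exp_add, Real.exp_log (hL_pos x hx),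
    Real.rpow_def_of_pos (by linarith), mul_comm]
  congr 2
  ring

lemma continuousOn_density (hL : SV 2 L) :
    ContinuousOn (fun x : ℝ => x ^ (-α) * L x) (Set.Ici 1) := by
  have h := hL.1 0 (by norm_num)
  rw [iteratedDerivWithin_zero] at h
  refine ContinuousOn.mul (fun x hx => ?_) h.continuousOn
  have : (0 : ℝ) < x := lt_of_lt_of_le one_pos hx
  exact (Real.continuousAt_rpow_const x (-α) (Or.inl this.ne')).continuousWithinAt

lemma LogLike.tendsto_sub_natCast {E : ℝ → ℝ} (hE : LogLike α E) {x : ℕ → ℝ} (hx : ∀ j : ℕ, j ≤ x j)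
    (hx' : ∀ j : ℕ, x j ≤ j + 2) : Tendsto (fun j : ℕ => E (x j) - E j) atTop (𝓝 0) := by
  have h := (tendsto_natCast_atTop_atTop (R := ℝ)).eventually
    (hE.eventually_lipschitz (C := |α| + 1) (by linarith))
  have hlim : Tendsto (fun j : ℕ => (|α| + 1) * 2 / (j : ℝ)) atTop (𝓝 0) :=
    tendsto_const_nhds.div_atTop tendsto_natCast_atTop_atTop
  refine squeeze_zero_norm' ?_ hlim
  filter_upwards [h, eventually_gt_atTop 0] with j hj hj0
  refine (hj _ (hx j)).trans ?_
  have := hx' j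
  gcongr
  linarith

/-- Increment of `a_n` over the window `(e^j, e^{j+1}]`. -/
def windowMass (w : ℕ → ℝ) (j : ℕ) : ℝ := aSeq w (expLabel (j + 1)) - aSeq w (expLabel j)

/-- After multiplication by e^{E(j)} the integrand is e^{-(E(t) - E(j))} = 1 + O(1/j), and the
length of the window tends to 1. -/
lemma tendsto_integral_density (hL_pos : ∀ x, 1 ≤ x → 0 < L x) (hL : SV 2 L) :
    Tendsto (fun j : ℕ => (∫ x in Real.log (expLabel j)..Real.log (expLabel (j + 1)),
      x ^ (-α) * L x) * Real.exp (logDensity α L j)) atTop (𝓝 1) := by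
  have hE : LogLike α (logDensity α L) := logLike_logDensity hL_pos hL
  set E := logDensity α L with hEdef
  set x : ℕ → ℝ := fun j => Real.log (expLabel j) with hx
  have hlen : Tendsto (fun j => x (j + 1) - x j) atTop (𝓝 1) := by
    have h1 := (tendsto_add_atTop_iff_nat 1).2 tendsto_log_expLabel_sub
    have h2 := (h1.sub tendsto_log_expLabel_sub).add_const 1
    rw [sub_zero, zero_add] at h2
    refine h2.congr fun j => ?_
    simp only [hx]; push_cast; ring
  have hxm : ∀ j, x j ≤ x (j + 1) := fun j => Real.log_le_log
    (by exact_mod_cast one_le_expLabel j) (by exact_mod_cast expLabel_mono (Nat.le_succ j))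
  suffices hdiff : Tendsto (fun j : ℕ => (∫ t in x j..x (j + 1), t ^ (-α) * L t) *
      Real.exp (E j) - (x (j + 1) - x j)) atTop (𝓝 0) by
    have := hdiff.add hlen
    rw [zero_add] at this
    exact this.congr fun j => by ring
  have hlip := (tendsto_natCast_atTop_atTop (R := ℝ)).eventually
    (hE.eventually_lipschitz (C := |α| + 1) (by linarith))
  have hlim0 : Tendsto (fun j : ℕ => (|α| + 1) * 2 / (j : ℝ)) atTop (𝓝 0) :=
    tendsto_const_nhds.div_atTop tendsto_natCast_atTop_atTop
  have hlim : Tendsto (fun j : ℕ => 2 * ((|α| + 1) * 2 / (j : ℝ)) * |x (j + 1) - x j|) atTop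
      (𝓝 (2 * 0 * |1|)) := (tendsto_const_nhds.mul hlim0).mul hlen.abs
  rw [mul_zero, zero_mul] at hlim
  refine squeeze_zero_norm' ?_ hlim
  filter_upwards [hlip, hlim0.eventually_le_const one_pos, eventually_ge_atTop 1] with j hj hsmall hj1
  have hj1' : (1 : ℝ) ≤ j := by exact_mod_cast hj1
  have hjx := le_log_expLabel j
  have hxj2 : x (j + 1) ≤ j + 2 := by
    have := log_expLabel_le_add_one (j + 1)
    push_cast at this
    simp only [hx]; linarith
  have hint : IntervalIntegrable (fun t : ℝ => t ^ (-α) * L t) volume (x j) (x (j + 1)) := by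
    refine ((continuousOn_density hL).mono ?_).intervalIntegrable
    rw [Set.uIcc_of_le (hxm j)]
    exact fun t ht => hj1'.trans (hjx.trans ht.1)
  have heq : (∫ t in x j..x (j + 1), t ^ (-α) * L t) * Real.exp (E j) - (x (j + 1) - x j) =
      ∫ t in x j..x (j + 1), (t ^ (-α) * L t * Real.exp (E j) - 1) := by
    rw [intervalIntegral.integral_sub (hint.mul_const _) intervalIntegrable_const,
      intervalIntegral.integral_mul_const]
    simp
  rw [heq]
  refine intervalIntegral.norm_integral_le_of_norm_le_const fun t ht => ?_
  rw [Set.uIoc_of_le (hxm j)] at ht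
  have htj : (j : ℝ) ≤ t := hjx.trans ht.1.le
  have h1 := hj t htj
  have h2 : |E t - E j| ≤ (|α| + 1) * 2 / j := h1.trans (by
    gcongr
    linarith [ht.2])
  have h3 : t ^ (-α) * L t * Real.exp (E j) = Real.exp (-(E t - E j)) := by
    rw [← exp_neg_logDensity hL_pos (hj1'.trans htj), ← Real.exp_add, ← hEdef]
    congr 1; ring
  have h4 : |(-(E t - E j))| ≤ 1 := by rw [abs_neg]; exact h2.trans hsmall
  rw [h3, Real.norm_eq_abs]
  refine (Real.abs_exp_sub_one_le h4).trans ?_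
  rw [abs_neg]
  gcongr

/-- Relative to e^{-E(log n)} the allowed error in a_n is o((log log n)²/log n), hence negligible at
both ends of a window; moving E from the ends to j changes it by o(1). -/
lemma tendsto_windowMass {w : ℕ → ℝ} (hL_pos : ∀ x, 1 ≤ x → 0 < L x) (hL : SV 2 L)
    (ha : (fun n : ℕ => aSeq w n - ∫ x in (1 : ℝ)..Real.log n, x ^ (-α) * L x)
      =o[atTop] fun n : ℕ =>
        Real.log n ^ (-1 - α) * Real.log (Real.log n) ^ 2 * L (Real.log n)) :
    Tendsto (fun j : ℕ => windowMass w j * Real.exp (logDensity α L j)) atTop (𝓝 1) := by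
  have hE : LogLike α (logDensity α L) := logLike_logDensity hL_pos hL
  set E := logDensity α L with hEdef
  set err : ℕ → ℝ := fun n => aSeq w n - ∫ x in (1 : ℝ)..Real.log n, x ^ (-α) * L x with herr
  have hsq : Tendsto (fun n : ℕ => Real.log (Real.log n) ^ 2 / Real.log n) atTop (𝓝 0) :=
    (Real.isLittleO_pow_log_id_atTop (n := 2)).tendsto_div_nhds_zero.comp tendsto_log_nat
  have herr0 : Tendsto (fun n : ℕ => err n * Real.exp (E (Real.log n))) atTop (𝓝 0) := by
    have h1 := ha.tendsto_div_nhds_zero.mul hsq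
    rw [mul_zero] at h1
    refine h1.congr' ?_
    filter_upwards [tendsto_log_nat.eventually_gt_atTop 1] with n hn
    have h2 := exp_neg_logDensity (α := α) hL_pos hn.le
    have hll := Real.log_pos hn
    have hn0 : 0 < Real.log n := by linarith
    have hLn := hL_pos _ hn.le
    have h3 : Real.exp (E (Real.log n)) = (Real.log n ^ (-α) * L (Real.log n))⁻¹ := by
      rw [← h2, ← Real.exp_neg, neg_neg]
    have h4 : Real.log n ^ (-1 - α) = Real.log n ^ (-α) / Real.log n := by
      rw [show -1 - α = -α - 1 by ring, Real.rpow_sub_one hn0.ne']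
    have h5 : 0 < Real.log n ^ (-α) := Real.rpow_pos_of_pos hn0 _
    rw [h3, h4]
    field_simp
  have hshift : ∀ k : ℕ, k ≤ 1 → Tendsto (fun j : ℕ => err (expLabel (j + k)) * Real.exp (E j))
      atTop (𝓝 0) := by
    intro k hk
    have h1 := herr0.comp (tendsto_expLabel.comp (tendsto_add_atTop_nat k))
    have hk' : (k : ℝ) ≤ 1 := by exact_mod_cast hk
    have h2 := hE.tendsto_sub_natCast (x := fun j => Real.log (expLabel (j + k)))
      (fun j => le_trans (by push_cast; simp) (le_log_expLabel (j + k)))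
      (fun j => (log_expLabel_le_add_one (j + k)).trans (by push_cast; linarith))
    have h3 := h1.mul ((Real.continuous_exp.tendsto _).comp h2.neg)
    rw [zero_mul] at h3
    refine h3.congr fun j => ?_
    simp only [Function.comp]
    rw [mul_assoc, ← Real.exp_add]
    congr 2; ring
  have h1 := (tendsto_integral_density (α := α) hL_pos hL).add
    ((hshift 1 le_rfl).sub (hshift 0 zero_le_one))
  rw [sub_zero, add_zero] at h1
  refine h1.congr' ?_
  filter_upwards [eventually_ge_atTop 1] with j hj
  have hj1 : (1 : ℝ) ≤ j := by exact_mod_cast hj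
  have hx : ∀ k : ℕ, (1 : ℝ) ≤ Real.log (expLabel (j + k)) := fun k =>
    le_trans (by push_cast; linarith [(Nat.cast_nonneg k : (0 : ℝ) ≤ k)]) (le_log_expLabel (j + k))
  have hint : ∀ k : ℕ, IntervalIntegrable (fun t : ℝ => t ^ (-α) * L t) volume 1
      (Real.log (expLabel (j + k))) := fun k => by
    refine ((continuousOn_density hL).mono ?_).intervalIntegrable
    rw [Set.uIcc_of_le (hx k)]
    exact fun t ht => ht.1
  have h2 := intervalIntegral.integral_interval_sub_left (hint 1) (hint 0)
  simp only [add_zero] at h2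
  simp only [herr, windowMass, add_zero]
  rw [← h2, ← hEdef]
  ring

end Density

/-! ### Consequences of the condition on squared weights -/

section Weights

variable {w : ℕ → ℝ}

lemma aSeq_succ (w : ℕ → ℝ) (n : ℕ) :
    aSeq w (n + 1) = aSeq w n + w (n + 1) / totalWeight w (n + 1) :=
  Finset.sum_Icc_succ_top (by omega) _

lemma eventually_two_mul_le_totalWeight (hw : ∀ i, 1 ≤ i → 0 ≤ w i) (hw1 : 0 < w 1)
    (hsum : Summable fun i : ℕ => w (i + 1) ^ 2 / totalWeight w (i + 1) ^ 2) :
    ∀ᶠ n : ℕ in atTop, totalWeight w (n + 1) ≤ 2 * totalWeight w n := by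
  filter_upwards [hsum.tendsto_atTop_zero.eventually_lt_const (show (0 : ℝ) < (1 / 2) ^ 2 by norm_num)]
    with n hn
  have hW := totalWeight_pos hw hw1 (show 1 ≤ n + 1 by omega)
  rw [← div_pow] at hn
  have h1 := lt_of_pow_lt_pow_left₀ 2 (by norm_num) hn
  rw [div_lt_iff₀ hW] at h1
  linarith [totalWeight_succ w n]

/-- log(W_{N+1}/W_N) ≤ w_{N+1}/W_N ≤ 2 w_{N+1}/W_{N+1}, the last by doubling. -/
lemma log_totalWeight_sub_le (hw : ∀ i, 1 ≤ i → 0 ≤ w i) (hw1 : 0 < w 1) {n₁ : ℕ}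
    (hn₁ : 1 ≤ n₁) (hdouble : ∀ n, n₁ ≤ n → totalWeight w (n + 1) ≤ 2 * totalWeight w n)
    {n N : ℕ} (hn : n₁ ≤ n) (hnN : n ≤ N) :
    Real.log (totalWeight w N) - Real.log (totalWeight w n) ≤ 2 * (aSeq w N - aSeq w n) := by
  induction N, hnN using Nat.le_induction with
  | base => simp
  | succ N hnN ih =>
    have hW := totalWeight_pos hw hw1 ((hn₁.trans hn).trans hnN)
    have hW' := totalWeight_pos hw hw1 (show 1 ≤ N + 1 by omega)
    have h1 := Real.log_le_sub_one_of_pos (div_pos hW' hW)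
    rw [Real.log_div hW'.ne' hW.ne'] at h1
    have h2 : totalWeight w (N + 1) / totalWeight w N - 1 ≤
        2 * (w (N + 1) / totalWeight w (N + 1)) := by
      have h3 : totalWeight w (N + 1) / totalWeight w N - 1 = w (N + 1) / totalWeight w N := by
        rw [totalWeight_succ]; field_simp; ring
      rw [h3, ← mul_div_assoc, div_le_div_iff₀ hW hW']
      have := mul_le_mul_of_nonneg_left (hdouble N (hn.trans hnN)) (hw (N + 1) (by omega))
      linarith
    rw [aSeq_succ]
    linarith

/-- W_i² ≤ 2 W_N W_{i-1} turns the variance of the attached weight into a tail of Σ w_i²/W_i². -/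
lemma sum_sq_div_le (hw : ∀ i, 1 ≤ i → 0 ≤ w i) (hw1 : 0 < w 1)
    (hsum : Summable fun i : ℕ => w (i + 1) ^ 2 / totalWeight w (i + 1) ^ 2) {n N : ℕ}
    (hn : 1 ≤ n) (hdouble : ∀ m, n ≤ m → totalWeight w (m + 1) ≤ 2 * totalWeight w m) :
    ∑ i ∈ Finset.Ioc n N, w i ^ 2 / totalWeight w (i - 1) ≤
      2 * totalWeight w N * ∑' i : ℕ, w (n + i) ^ 2 / totalWeight w (n + i) ^ 2 := by
  have hs : Summable fun i : ℕ => w (n + i) ^ 2 / totalWeight w (n + i) ^ 2 := by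
    refine ((summable_nat_add_iff (n - 1)).2 hsum).congr fun i => ?_
    have : i + (n - 1) + 1 = n + i := by omega
    rw [this]
  have hWN : 0 ≤ totalWeight w N := Finset.sum_nonneg fun i hi => hw i (Finset.mem_Icc.1 hi).1
  have h1 : ∑ i ∈ Finset.Ioc n N, w i ^ 2 / totalWeight w i ^ 2 ≤
      ∑' i : ℕ, w (n + i) ^ 2 / totalWeight w (n + i) ^ 2 := by
    calc _ ≤ ∑ i ∈ Finset.Ico n (N + 1), w i ^ 2 / totalWeight w i ^ 2 :=
          Finset.sum_le_sum_of_subset_of_nonneg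
            (fun i hi => by rw [Finset.mem_Ioc] at hi; rw [Finset.mem_Ico]; omega)
            (fun i _ _ => by positivity)
      _ = ∑ i ∈ Finset.range (N + 1 - n), w (n + i) ^ 2 / totalWeight w (n + i) ^ 2 :=
          Finset.sum_Ico_eq_sum_range _ _ _
      _ ≤ _ := hs.sum_le_tsum _ fun i _ => by positivity
  refine le_trans ?_ (mul_le_mul_of_nonneg_left h1 (by positivity))
  rw [Finset.mul_sum]
  refine Finset.sum_le_sum fun i hi => ?_
  rw [Finset.mem_Ioc] at hi
  obtain ⟨k, rfl⟩ : ∃ k, i = k + 1 := ⟨i - 1, by omega⟩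
  have hW := totalWeight_pos hw hw1 (show 1 ≤ k by omega)
  have hW' := totalWeight_pos hw hw1 (show 1 ≤ k + 1 by omega)
  have h2 := hdouble k (by omega)
  have h3 : totalWeight w (k + 1) ≤ totalWeight w N := totalWeight_mono hw hi.2
  rw [Nat.add_sub_cancel, ← mul_div_assoc, div_le_div_iff₀ hW (by positivity)]
  have h4 : totalWeight w (k + 1) ^ 2 ≤ 2 * totalWeight w N * totalWeight w k := by nlinarith
  nlinarith [mul_le_mul_of_nonneg_left h4 (sq_nonneg (w (k + 1)))]

end Weights

lemma ae_eventually_notMem_of_summable {Ω : Type*} [MeasurableSpace Ω] {μ : Measure Ω}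
    [IsFiniteMeasure μ] {s : ℕ → Set Ω} {f : ℕ → ℝ} (hf : Summable f)
    (h : ∀ᶠ i in atTop, μ.real (s i) ≤ f i) : ∀ᵐ ω ∂μ, ∀ᶠ i in atTop, ω ∉ s i := by
  have h1 : Summable fun i => μ.real (s i) := by
    refine Summable.of_norm_bounded_eventually_nat hf ?_
    filter_upwards [h] with i hi
    rwa [Real.norm_of_nonneg measureReal_nonneg]
  refine ae_eventually_notMem ?_
  have := h1.tsum_ofReal_ne_top
  simpa [ofReal_measureReal] using this

/-! ### Almost sure lower bound -/

section Lower

variable {α : ℝ} {E : ℝ → ℝ} {w : ℕ → ℝ}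

lemma LogLike.tendsto_log_mul_exp_neg (hE : LogLike α E) (hα : 0 < α) :
    Tendsto (fun x => Real.log x * Real.exp (-E x)) atTop (𝓝 0) := by
  have h1 : Tendsto (fun y : ℝ => y * Real.exp (-(α / 2) * y)) atTop (𝓝 0) := by
    have := tendsto_rpow_mul_exp_neg_mul_atTop_nhds_zero 1 (α / 2) (by positivity)
    simpa using this
  have h2 := h1.comp Real.tendsto_log_atTop
  have h3 : ∀ᶠ x in atTop, α / 2 < E x / Real.log x :=
    hE.tendsto_div_log.eventually_const_lt (by linarith)
  refine tendsto_of_tendsto_of_tendsto_of_le_of_le' tendsto_const_nhds h2 ?_ ?_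
  · filter_upwards [eventually_gt_atTop 1] with x hx
    have := Real.log_pos hx
    positivity
  · filter_upwards [eventually_gt_atTop 1, h3] with x hx hx3
    have hl := Real.log_pos hx
    rw [lt_div_iff₀ hl] at hx3
    simp only [Function.comp]
    gcongr
    linarith

/-- Each window raises log W by at most 4e^{-E(j)}, and log j · e^{-E(j)} → 0, so C log j windows
change it by o(1). -/
lemma LogLike.slowlyIncreasing_log_totalWeight (hE : LogLike α E) (hα : 0 < α)
    (hw : ∀ i, 1 ≤ i → 0 ≤ w i) (hw1 : 0 < w 1)
    (hsum : Summable fun i : ℕ => w (i + 1) ^ 2 / totalWeight w (i + 1) ^ 2)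
    (hb : Tendsto (fun j : ℕ => windowMass w j * Real.exp (E j)) atTop (𝓝 1)) :
    SlowlyIncreasing fun j => Real.log (totalWeight w (expLabel (j + 1))) := by
  intro C δ hC hδ
  obtain ⟨n₁, hn₁⟩ := ((eventually_two_mul_le_totalWeight hw hw1 hsum).and
    (eventually_ge_atTop 1)).exists_forall_of_atTop
  obtain ⟨X, hX, hX1⟩ := ((hE.eventually_monotone hα).and (eventually_ge_atTop 1)).exists
  have h4 : Tendsto (fun j : ℕ => 4 * C * (Real.log j * Real.exp (-E j))) atTop (𝓝 (4 * C * 0)) :=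
    tendsto_const_nhds.mul ((hE.tendsto_log_mul_exp_neg hα).comp tendsto_natCast_atTop_atTop)
  rw [mul_zero] at h4
  obtain ⟨J, hJ⟩ := (hb.eventually_lt_const one_lt_two).exists_forall_of_atTop
  filter_upwards [h4.eventually_lt_const hδ, eventually_ge_atTop J,
    tendsto_natCast_atTop_atTop.eventually_ge_atTop X,
    tendsto_expLabel.eventually_ge_atTop n₁] with j h5 hj hjX hjn i hi
  have hmass : ∀ l : ℕ, j ≤ l → windowMass w l ≤ 2 * Real.exp (-E j) := by
    intro l hl
    have h6 := (hJ l (hj.trans hl)).le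
    have hl' : (j : ℝ) ≤ l := by exact_mod_cast hl
    have h7 : E j ≤ E l := hX (Set.mem_Ici.2 hjX) (Set.mem_Ici.2 (hjX.trans hl')) hl'
    rw [← le_div_iff₀ (Real.exp_pos _), div_eq_mul_inv, ← Real.exp_neg] at h6
    refine h6.trans ?_
    gcongr
  have hinc : ∀ i : ℕ, aSeq w (expLabel (j + i + 1)) - aSeq w (expLabel (j + 1)) ≤
      i * (2 * Real.exp (-E j)) := by
    intro i
    induction i with
    | zero => simp
    | succ i ih =>
      have := hmass (j + i + 1) (by omega)
      rw [windowMass] at this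
      push_cast
      rw [show j + (i + 1) + 1 = j + i + 1 + 1 by ring]
      linarith
  have h8 := log_totalWeight_sub_le hw hw1 (hn₁ n₁ le_rfl).2 (fun n hn => (hn₁ n hn).1)
    (hjn.trans (expLabel_mono (Nat.le_succ j)))
    (expLabel_mono (show j + 1 ≤ j + i + 1 by omega))
  have h9 := hinc i
  have h10 : (i : ℝ) * (2 * Real.exp (-E j)) ≤ C * Real.log j * (2 * Real.exp (-E j)) := by
    gcongr
  linarith

variable {Ω : Type*} [MeasurableSpace Ω] {μ : Measure Ω} [IsProbabilityMeasure μ] {K : ℕ → Ω → ℕ}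

lemma IsWRT.ae_eventually_recursion (hK : IsWRT μ w K) (hE : LogLike α E)
    (hw : ∀ i, 1 ≤ i → 0 ≤ w i) (hw1 : 0 < w 1)
    (hsum : Summable fun i : ℕ => w (i + 1) ^ 2 / totalWeight w (i + 1) ^ 2)
    (hsq : (fun n : ℕ => ∑' i : ℕ, w (n + i) ^ 2 / totalWeight w (n + i) ^ 2)
      =O[atTop] fun n : ℕ => 1 / (n : ℝ))
    (hb : Tendsto (fun j : ℕ => windowMass w j * Real.exp (E j)) atTop (𝓝 1)) {ε : ℝ}
    (hε : 0 < ε) :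
    ∀ᵐ ω ∂μ, ∀ᶠ j : ℕ in atTop, ∀ h ≤ j,
      Real.exp (-j + (Real.log (totalWeight w (expLabel (j + 1))) +
        (2 * α + 5) * Real.log j)) ≤ heavyWeight w (fun i => K i ω) (expLabel j) h →
      heavyWeight w (fun i => K i ω) (expLabel j) (h + 1) + (1 - ε) * windowMass w j *
        heavyWeight w (fun i => K i ω) (expLabel j) h ≤
        heavyWeight w (fun i => K i ω) (expLabel (j + 1)) (h + 1) := by
  obtain ⟨C, hC0, hC⟩ := hsq.exists_pos
  obtain ⟨n₁, hn₁⟩ := (eventually_two_mul_le_totalWeight hw hw1 hsum).exists_forall_of_atTop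
  -- The exponent is 2α + 5 = 2(α + 1) + 3. The squared window mass is at least j^{-2(α+1)}/4 and
  -- the variance bound is O(W e^{-j}), so a single height fails with probability O(j^{-3}); the
  -- union over the j + 1 heights leaves the summable O(j^{-2}).
  set θ : ℕ → ℝ := fun j => Real.exp (-j + (Real.log (totalWeight w (expLabel (j + 1))) +
        (2 * α + 5) * Real.log j)) with hθ
  set bad : ℕ → ℕ → Set Ω := fun j h =>
    {ω | θ j ≤ heavyWeight w (fun i => K i ω) (expLabel j) h ∧
      heavyWeight w (fun i => K i ω) (expLabel (j + 1)) (h + 1) <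
        heavyWeight w (fun i => K i ω) (expLabel j) (h + 1) +
        (1 - ε) * windowMass w j * heavyWeight w (fun i => K i ω) (expLabel j) h} with hbad
  have hsumm : Summable fun j : ℕ => 16 * C / ε ^ 2 * ((j : ℝ) ^ 2)⁻¹ :=
    (Real.summable_nat_pow_inv.2 one_lt_two).mul_left _
  have hE1 := (tendsto_natCast_atTop_atTop (R := ℝ)).eventually
    (hE.eventually_div_log_lt (c := α + 1) (by linarith))
  have hbound : ∀ᶠ j in atTop, μ.real (⋃ h ∈ Finset.range (j + 1), bad j h) ≤
      16 * C / ε ^ 2 * ((j : ℝ) ^ 2)⁻¹ := by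
    filter_upwards [hb.eventually_const_lt (show (1 / 2 : ℝ) < 1 by norm_num), hE1,
      tendsto_expLabel.eventually hC.bound, tendsto_expLabel.eventually_ge_atTop n₁,
      eventually_ge_atTop 2] with j hj1 hj2 hj3 hj4 hj5
    have hj0 : (1 : ℝ) < j := by exact_mod_cast hj5
    have hl := Real.log_pos hj0
    have hWN := totalWeight_pos hw hw1 (one_le_expLabel (j + 1))
    set N := expLabel (j + 1) with hN
    set n := expLabel j with hn
    have hn1 : 1 ≤ n := one_le_expLabel j
    have hn0 : (0 : ℝ) < n := by exact_mod_cast hn1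
    rw [div_lt_iff₀ hl] at hj2
    have hmass : Real.exp (-((α + 1) * Real.log j)) / 2 ≤ windowMass w j := by
      have h1 : Real.exp (-E j) / 2 ≤ windowMass w j := by
        rw [Real.exp_neg, ← one_div, div_div, div_le_iff₀ (by positivity)]
        linarith
      refine le_trans ?_ h1
      gcongr
    have hmass0 : 0 < windowMass w j := lt_of_lt_of_le (by positivity) hmass
    have hV : ∑ i ∈ Finset.Ioc n N, w i ^ 2 / totalWeight w (i - 1) ≤
        2 * totalWeight w N * (C * Real.exp (-j)) := by
      refine (sum_sq_div_le hw hw1 hsum hn1 fun m hm => hn₁ m (hj4.trans hm)).trans ?_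
      have h2 : ∑' i : ℕ, w (n + i) ^ 2 / totalWeight w (n + i) ^ 2 ≤ C * (1 / n) := by
        have := (le_abs_self _).trans hj3
        rwa [Real.norm_of_nonneg (by positivity)] at this
      have h3 : (1 : ℝ) / n ≤ Real.exp (-j) := by
        rw [Real.exp_neg, one_div]
        exact inv_anti₀ (Real.exp_pos _) (exp_le_expLabel j)
      gcongr
      exact h2.trans (by gcongr)
    have hθj : θ j = totalWeight w N * Real.exp (-j) * Real.exp ((2 * α + 5) * Real.log j) := by
      simp only [hθ]
      rw [Real.exp_add, Real.exp_add, Real.exp_log hWN]; ring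
    have hone : ∀ h, μ.real (bad j h) ≤ 8 * C / ε ^ 2 * (((j : ℝ) ^ 2)⁻¹ * (j : ℝ)⁻¹) := by
      intro h
      refine (hK.measureReal_heavyWeight_lt_le hw hw1 hn1 h (expLabel_mono (Nat.le_succ j))
        (θ := θ j) (Real.exp_pos _) hε hmass0).trans ?_
      change _ / (θ j * (ε * windowMass w j) ^ 2) ≤ _
      have h4 : totalWeight w N * Real.exp (-j) * (ε ^ 2 / 4) * (j : ℝ) ^ 3 ≤
          θ j * (ε * windowMass w j) ^ 2 := by
        have h5 : (Real.exp (-((α + 1) * Real.log j)) / 2) ^ 2 ≤ windowMass w j ^ 2 :=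
          pow_le_pow_left₀ (by positivity) hmass 2
        have h6 : Real.exp ((2 * α + 5) * Real.log j) *
            (Real.exp (-((α + 1) * Real.log j)) / 2) ^ 2 = (j : ℝ) ^ 3 / 4 := by
          have h7 : (j : ℝ) ^ 3 = Real.exp (3 * Real.log j) := by
            rw [show (3 : ℝ) * Real.log j = ((3 : ℕ) : ℝ) * Real.log j by norm_num,
              Real.exp_nat_mul, Real.exp_log (by linarith)]
          rw [div_pow, ← Real.exp_nat_mul, ← mul_div_assoc, ← Real.exp_add, h7]
          congr 1
          · congr 1; push_cast; ring
          · norm_num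
        rw [hθj]
        calc _ = totalWeight w N * Real.exp (-j) * ε ^ 2 * ((j : ℝ) ^ 3 / 4) := by ring
          _ = totalWeight w N * Real.exp (-j) * ε ^ 2 * (Real.exp ((2 * α + 5) * Real.log j) *
            (Real.exp (-((α + 1) * Real.log j)) / 2) ^ 2) := by rw [h6]
          _ ≤ totalWeight w N * Real.exp (-j) * ε ^ 2 * (Real.exp ((2 * α + 5) * Real.log j) *
            windowMass w j ^ 2) := by gcongr
          _ = _ := by ring
      calc _ ≤ 2 * totalWeight w N * (C * Real.exp (-j)) /
            (totalWeight w N * Real.exp (-j) * (ε ^ 2 / 4) * (j : ℝ) ^ 3) := by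
            gcongr
        _ = _ := by
            have := (Real.exp_pos (-(j : ℝ))).ne'
            field_simp
            norm_num
    calc μ.real (⋃ h ∈ Finset.range (j + 1), bad j h)
        ≤ ∑ h ∈ Finset.range (j + 1), μ.real (bad j h) := measureReal_biUnion_finset_le _ _
      _ ≤ ∑ h ∈ Finset.range (j + 1), 8 * C / ε ^ 2 * (((j : ℝ) ^ 2)⁻¹ * (j : ℝ)⁻¹) :=
          Finset.sum_le_sum fun h _ => hone h
      _ = 8 * C / ε ^ 2 * ((j : ℝ) ^ 2)⁻¹ * ((j + 1) / j) := by
          rw [Finset.sum_const, Finset.card_range, nsmul_eq_mul]; push_cast; ring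
      _ ≤ 8 * C / ε ^ 2 * ((j : ℝ) ^ 2)⁻¹ * 2 := by
          gcongr
          rw [div_le_iff₀ (by linarith)]
          linarith
      _ = _ := by ring
  filter_upwards [ae_eventually_notMem_of_summable hsumm hbound] with ω hω
  filter_upwards [hω] with j hj h hh hle
  by_contra hcon
  refine hj (Set.mem_biUnion (Finset.mem_coe.2 (Finset.mem_range.2 (Nat.lt_succ_of_le hh))) ?_)
  exact ⟨hle, not_le.1 hcon⟩

theorem IsWRT.ae_eventually_profile_le (hK : IsWRT μ w K) (hE : LogLike α E) (hα : 0 < α)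
    (hw : ∀ i, 1 ≤ i → 0 ≤ w i) (hw1 : 0 < w 1)
    (hsum : Summable fun i : ℕ => w (i + 1) ^ 2 / totalWeight w (i + 1) ^ 2)
    (hsq : (fun n : ℕ => ∑' i : ℕ, w (n + i) ^ 2 / totalWeight w (n + i) ^ 2)
      =O[atTop] fun n : ℕ => 1 / (n : ℝ))
    (hb : Tendsto (fun j : ℕ => windowMass w j * Real.exp (E j)) atTop (𝓝 1)) {c : ℝ}
    (hc : 0 < c) :
    ∀ᵐ ω ∂μ, ∀ᶠ n : ℕ in atTop,
      profile α E (-c) (Real.log n) ≤ treeHeight (fun i => K i ω) n := by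
  obtain ⟨ε, hε, -, hmain⟩ := hE.exists_height_of_recursion hα hc
  have hζ : SlowlyIncreasing fun j => Real.log (totalWeight w (expLabel (j + 1))) +
      (2 * α + 5) * Real.log j :=
    (hE.slowlyIncreasing_log_totalWeight hα hw hw1 hsum hb).add
      (slowlyIncreasing_mul_log (by positivity))
  filter_upwards [hK.ae_eventually_recursion hE hw hw1 hsum hsq hb hε] with ω hω
  have h1 := hmain (windowMass w) _
    (fun j h => heavyWeight w (fun i => K i ω) (expLabel j) h) (w 1) hb hζ
    (fun j h => heavyWeight_mono hw h (expLabel_mono (Nat.le_succ j)))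
    (fun j h => heavyWeight_nonneg hw _ h) hw1
    (Eventually.of_forall fun j => by
      rw [heavyWeight_zero]
      calc w 1 = totalWeight w 1 := by simp [totalWeight]
        _ ≤ _ := totalWeight_mono hw (one_le_expLabel j)) hω
  filter_upwards [tendsto_log_nat.eventually h1, eventually_ge_atTop 1] with n ⟨h, hh, hpos⟩ hn
  refine hh.trans ?_
  exact_mod_cast le_treeHeight_of_heavyWeight_pos
    (hpos.trans_le (heavyWeight_mono hw h (expLabel_floor_log_le hn)))

end Lower

/-! ### Almost sure upper bound -/

lemma summable_one_div_mul_log_sq : Summable fun n : ℕ => 1 / ((n : ℝ) * Real.log n ^ 2) := by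
  refine (summable_condensed_iff_of_eventually_nonneg ?_ ?_).1 ?_
  · exact Eventually.of_forall fun n => by simp only [Pi.zero_apply]; positivity
  · filter_upwards [eventually_ge_atTop 2] with n hn
    have hn1 : (1 : ℝ) < n := by exact_mod_cast hn
    have hl := Real.log_pos hn1
    have h1 : Real.log n ≤ Real.log ((n + 1 : ℕ) : ℝ) :=
      Real.log_le_log (by linarith) (by push_cast; linarith)
    have h2 : (n : ℝ) ≤ ((n + 1 : ℕ) : ℝ) := by push_cast; linarith
    gcongr
  · refine ((Real.summable_nat_pow_inv.2 one_lt_two).mul_left ((Real.log 2 ^ 2)⁻¹)).congr fun k => ?_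
    push_cast
    rw [Real.log_pow]
    have : (2 : ℝ) ^ k ≠ 0 := by positivity
    field_simp

section Upper

variable {α : ℝ} {E : ℝ → ℝ} {w : ℕ → ℝ}

/-- The slope of (1 + ε/2) x/(α log x) is asymptotic to (1 + ε/2)/(α log x). Increments of this
function thus dominate the contributions of successive windows, whose sum telescopes. -/
lemma eventually_increment_ge (hα : 0 < α) {ε : ℝ} (hε : 0 < ε) :
    ∀ᶠ x in atTop, ∀ y, x + 1 ≤ y →
      (1 + ε / 4) / (α * Real.log y) ≤ (1 + ε / 2) * ((x + 1) / (α * Real.log (x + 1))) -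
        (1 + ε / 2) * (x / (α * Real.log x)) := by
  have hlim : Tendsto (fun t => (1 + ε / 2) * (1 - 1 / Real.log t)) atTop
      (𝓝 ((1 + ε / 2) * (1 - 0))) :=
    tendsto_const_nhds.mul (tendsto_const_nhds.sub tendsto_inv_log)
  obtain ⟨X, hX⟩ := ((hlim.eventually_const_lt
    (show 1 + ε / 4 < (1 + ε / 2) * (1 - 0) by linarith)).and
      (eventually_gt_atTop 1)).exists_forall_of_atTop
  filter_upwards [eventually_ge_atTop X] with x hx y hy
  have hx1 := (hX x hx).2
  have hly : 0 < Real.log y := Real.log_pos (by linarith)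
  set Q : ℝ → ℝ := fun t => (1 + ε / 2) * (t / (α * Real.log t)) with hQ
  have hmono : MonotoneOn (fun t => Q t - (1 + ε / 4) / (α * Real.log y) * t)
      (Set.Icc x (x + 1)) := by
    have hder : ∀ t ∈ Set.Icc x (x + 1),
        HasDerivAt (fun t => Q t - (1 + ε / 4) / (α * Real.log y) * t)
          ((1 + ε / 2) * ((1 - 1 / Real.log t) / (α * Real.log t)) -
            (1 + ε / 4) / (α * Real.log y)) t := fun t ht => by
      have h1 := ((hasDerivAt_div_mul_log hα (hx1.trans_le ht.1)).const_mul (1 + ε / 2)).sub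
        ((hasDerivAt_id t).const_mul ((1 + ε / 4) / (α * Real.log y)))
      rwa [mul_one] at h1
    refine monotoneOn_of_deriv_nonneg (convex_Icc x (x + 1))
      (fun t ht => (hder t ht).continuousAt.continuousWithinAt)
      (fun t ht => (hder t (interior_subset ht)).differentiableAt.differentiableWithinAt)
      (fun t ht => ?_)
    have ht' := interior_subset ht
    rw [(hder t ht').deriv]
    obtain ⟨h2, h3⟩ := hX t (hx.trans ht'.1)
    have hlt := Real.log_pos h3
    have h4 : Real.log t ≤ Real.log y := Real.log_le_log (by linarith) (ht'.2.trans hy)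
    have h5 : (1 + ε / 4) / (α * Real.log y) ≤ (1 + ε / 4) / (α * Real.log t) := by
      gcongr
    have h6 : (1 + ε / 4) / (α * Real.log t) ≤
        (1 + ε / 2) * (1 - 1 / Real.log t) / (α * Real.log t) := by
      gcongr
    rw [mul_div_assoc] at h6
    linarith
  have h7 := hmono (Set.left_mem_Icc.2 (by linarith)) (Set.right_mem_Icc.2 (by linarith))
    (show x ≤ x + 1 by linarith)
  simp only [hQ] at h7
  linarith

/-- e^D = e^E/(α log x), and the factor e^E cancels the window mass, also when E is taken at the
right end of the window. -/
lemma LogLike.eventually_exp_cost_mul_windowMass_le (hE : LogLike α E) (hα : 0 < α)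
    (hb : Tendsto (fun j : ℕ => windowMass w j * Real.exp (E j)) atTop (𝓝 1)) {ε : ℝ}
    (hε : 0 < ε) :
    ∀ᶠ j : ℕ in atTop, Real.exp (WRT.cost α E (Real.log (expLabel (j + 1)))) * windowMass w j ≤
      (1 + ε) / (α * Real.log (Real.log (expLabel (j + 1)))) := by
  have h1 := hE.tendsto_sub_natCast (x := fun j => Real.log (expLabel (j + 1)))
    (fun j => le_trans (by push_cast; simp) (le_log_expLabel (j + 1)))
    (fun j => (log_expLabel_le_add_one (j + 1)).trans (by push_cast; linarith))
  have h2 := hb.mul ((Real.continuous_exp.tendsto _).comp h1)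
  rw [Real.exp_zero, mul_one] at h2
  filter_upwards [h2.eventually_lt_const (show 1 < 1 + ε by linarith), eventually_ge_atTop 1]
    with j hj hj1
  have hx1 : 1 < Real.log (expLabel (j + 1)) := by
    have h3 := le_log_expLabel (j + 1)
    have h4 : (1 : ℝ) ≤ j := by exact_mod_cast hj1
    push_cast at h3
    linarith
  have hl := Real.log_pos hx1
  simp only [Function.comp] at hj
  rw [mul_assoc, ← Real.exp_add, add_sub_cancel] at hj
  rw [le_div_iff₀ (by positivity), WRT.cost, Real.exp_sub, Real.exp_sub, Real.exp_log hl,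
    Real.exp_log hα]
  refine le_trans (le_of_eq ?_) hj.le
  field_simp

lemma LogLike.eventually_sum_exp_labelCost_le (hE : LogLike α E) (hα : 0 < α)
    (hw : ∀ i, 1 ≤ i → 0 ≤ w i) (hw1 : 0 < w 1)
    (hb : Tendsto (fun j : ℕ => windowMass w j * Real.exp (E j)) atTop (𝓝 1)) {ε : ℝ}
    (hε : 0 < ε) :
    ∀ᶠ n₀ : ℕ in atTop, ∃ C, ∀ᶠ n : ℕ in atTop,
      ∑ i ∈ Finset.Icc 2 n, (Real.exp (labelCost α E n₀ i) - 1) * (w i / totalWeight w i) ≤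
        (1 + ε / 2) * (Real.log n / (α * Real.log (Real.log n))) + C := by
  have hmono' := tendsto_log_nat.eventually ((hE.cost.eventually_monotone hα).and
    ((hE.cost.tendsto_atTop hα).eventually_ge_atTop 0))
  filter_upwards [hmono', eventually_ge_atTop 1] with n₀ ⟨hmono, hD0⟩ hn₀
  set T : ℕ → ℝ := fun n => ∑ i ∈ Finset.Icc 2 n,
    (Real.exp (labelCost α E n₀ i) - 1) * (w i / totalWeight w i) with hT
  set Q : ℝ → ℝ := fun t => (1 + ε / 2) * (t / (α * Real.log t)) with hQ
  have hp : ∀ i, 1 ≤ i → 0 ≤ w i / totalWeight w i := fun i hi =>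
    div_nonneg (hw i hi) (totalWeight_pos hw hw1 hi).le
  have hlog : ∀ {k m : ℕ}, n₀ ≤ k → k ≤ m → Real.log k ≤ Real.log m := fun {k m} hk hkm =>
    Real.log_le_log (by exact_mod_cast (by omega : 0 < k)) (by exact_mod_cast hkm)
  have hcm : ∀ {k m : ℕ}, n₀ ≤ k → k ≤ m →
      WRT.cost α E (Real.log k) ≤ WRT.cost α E (Real.log m) := fun {k m} hk hkm =>
    hmono (Set.mem_Ici.2 (hlog le_rfl hk)) (Set.mem_Ici.2 (hlog le_rfl (hk.trans hkm)))
      (hlog hk hkm)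
  have hTsucc : ∀ n, 1 ≤ n → T (n + 1) = T n + (Real.exp (labelCost α E n₀ (n + 1)) - 1) *
      (w (n + 1) / totalWeight w (n + 1)) := fun n hn =>
    Finset.sum_Icc_succ_top (by omega) _
  have hlc : ∀ i, 0 ≤ labelCost α E n₀ i := by
    intro i
    rw [labelCost]
    split_ifs with h
    · exact hD0.trans (hcm le_rfl h.le)
    · exact le_rfl
  have hTm : ∀ {n m}, 1 ≤ n → n ≤ m → T n ≤ T m := by
    intro n m hn hnm
    refine Finset.sum_le_sum_of_subset_of_nonneg (Finset.Icc_subset_Icc le_rfl hnm)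
      fun i hi _ => mul_nonneg ?_ (hp i (by have := Finset.mem_Icc.1 hi; omega))
    linarith [Real.add_one_le_exp (labelCost α E n₀ i), hlc i]
  have hstep : ∀ n m N, n₀ ≤ n → n ≤ m → m ≤ N →
      T m - T n ≤ Real.exp (WRT.cost α E (Real.log N)) * (aSeq w m - aSeq w n) := by
    intro n m N hn hnm hmN
    induction m, hnm using Nat.le_induction with
    | base => simp
    | succ m hnm ih =>
      have h1 := ih (by omega)
      rw [hTsucc m (by omega), aSeq_succ]
      have h2 : Real.exp (labelCost α E n₀ (m + 1)) - 1 ≤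
          Real.exp (WRT.cost α E (Real.log N)) := by
        have h3 : labelCost α E n₀ (m + 1) ≤ WRT.cost α E (Real.log N) := by
          rw [labelCost, if_pos (by omega)]
          exact hcm (by omega) hmN
        linarith [Real.exp_le_exp.2 h3]
      have h4 := mul_le_mul_of_nonneg_right h2 (hp (m + 1) (by omega))
      linarith
  obtain ⟨J, hJ⟩ := ((hE.eventually_exp_cost_mul_windowMass_le hα hb
    (show 0 < ε / 4 by linarith)).and
    (((tendsto_natCast_atTop_atTop (R := ℝ)).eventually (eventually_increment_ge hα hε)).and
      (tendsto_expLabel.eventually_ge_atTop n₀))).exists_forall_of_atTop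
  have hind : ∀ k, T (expLabel (J + k + 1)) ≤ Q (J + k : ℕ) + (T (expLabel (J + 1)) - Q J) := by
    intro k
    induction k with
    | zero => simp
    | succ k ih =>
      have h1 := (hJ (J + k + 1) (by omega)).1
      have h2 := (hJ (J + k) (by omega)).2.1 (Real.log (expLabel (J + k + 1 + 1)))
        (by
          have := le_log_expLabel (J + k + 1 + 1)
          push_cast at this ⊢
          linarith)
      have h3 := hstep _ _ _ ((hJ (J + k) (by omega)).2.2.trans
        (expLabel_mono (Nat.le_succ (J + k)))) (expLabel_mono (Nat.le_succ (J + k + 1))) le_rfl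
      rw [windowMass] at h1
      have h4 : Q ((J + (k + 1) : ℕ) : ℝ) = (1 + ε / 2) * ((((J + k : ℕ) : ℝ) + 1) /
          (α * Real.log (((J + k : ℕ) : ℝ) + 1))) := by
        simp only [hQ]; push_cast; ring_nf
      rw [h4]
      change T (expLabel (J + k + 1 + 1)) ≤ _
      have h5 : Q ((J + k : ℕ) : ℝ) = (1 + ε / 2) * (((J + k : ℕ) : ℝ) /
          (α * Real.log ((J + k : ℕ) : ℝ))) := rfl
      linarith
  have hQm : ∀ᶠ X in atTop, MonotoneOn Q (Set.Ici X) := by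
    have hQd : ∀ t : ℝ, 1 < t → HasDerivAt Q
        ((1 + ε / 2) * ((1 - 1 / Real.log t) / (α * Real.log t))) t := fun t ht =>
      (hasDerivAt_div_mul_log hα ht).const_mul _
    filter_upwards [eventually_ge_atTop (Real.exp 1)] with X hX
    have hge : ∀ t ∈ Set.Ici X, 1 < t := fun t ht =>
      lt_of_lt_of_le (by have := Real.add_one_le_exp (1 : ℝ); linarith) (hX.trans ht)
    refine monotoneOn_of_deriv_nonneg (convex_Ici X)
      (fun t ht => (hQd t (hge t ht)).continuousAt.continuousWithinAt)
      (fun t ht => (hQd t (hge t (interior_subset ht))).differentiableAt.differentiableWithinAt)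
      (fun t ht => ?_)
    have ht' := interior_subset ht
    rw [(hQd t (hge t ht')).deriv]
    have h1 : 1 ≤ Real.log t := by
      rw [Real.le_log_iff_exp_le (by linarith [hge t ht'])]
      exact hX.trans ht'
    have h2 : 1 / Real.log t ≤ 1 := by rw [div_le_one (by linarith)]; exact h1
    have h3 : 0 ≤ 1 - 1 / Real.log t := by linarith
    have h4 : 0 ≤ Real.log t := by linarith
    positivity
  obtain ⟨X, hX⟩ := hQm.exists
  refine ⟨T (expLabel (J + 1)) - Q J, ?_⟩
  filter_upwards [eventually_ge_atTop 1, tendsto_log_nat.eventually_ge_atTop ((J : ℕ) : ℝ),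
    tendsto_log_nat.eventually_ge_atTop (X + 1)] with n hn hnJ hnX
  obtain ⟨k, hk⟩ := Nat.exists_eq_add_of_le (Nat.le_floor hnJ)
  have h1 := hind k
  rw [← hk] at h1
  have h2 : T n ≤ T (expLabel (⌊Real.log n⌋₊ + 1)) := hTm hn (le_expLabel_floor_log hn)
  have h3 : Q (⌊Real.log n⌋₊ : ℕ) ≤ Q (Real.log n) := by
    have h4 := Nat.lt_floor_add_one (Real.log n)
    exact hX (Set.mem_Ici.2 (by linarith)) (Set.mem_Ici.2 (by linarith))
      (Nat.floor_le (Real.log_nonneg (by exact_mod_cast hn)))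
  exact h2.trans (h1.trans (add_le_add h3 le_rfl))

variable {Ω : Type*} [MeasurableSpace Ω] {μ : Measure Ω} [IsProbabilityMeasure μ] {K : ℕ → Ω → ℕ}

theorem IsWRT.ae_eventually_le_profile (hK : IsWRT μ w K) (hE : LogLike α E) (hα : 0 < α)
    (hw : ∀ i, 1 ≤ i → 0 ≤ w i) (hw1 : 0 < w 1)
    (hb : Tendsto (fun j : ℕ => windowMass w j * Real.exp (E j)) atTop (𝓝 1)) {c : ℝ}
    (hc : 0 < c) :
    ∀ᵐ ω ∂μ, ∀ᶠ n : ℕ in atTop,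
      (treeHeight (fun i => K i ω) n : ℝ) ≤ profile α E c (Real.log n) := by
  have hε : 0 < c / 2 := by linarith
  set ε := c / 2 with hεdef
  obtain ⟨n₀, hdet, ⟨C, hC⟩, hn₀⟩ := ((hE.eventually_treeHeight_le hα hε
    (show ε < c by linarith)).and ((hE.eventually_sum_exp_labelCost_le hα hw hw1 hb hε).and
      (eventually_ge_atTop 1))).exists
  set f := labelCost α E n₀ with hf
  set bad : ℕ → Set Ω := fun n =>
    {ω | barrier α ε (Real.log n) ≤ pathSum f (fun i => K i ω) n} with hbad
  -- The barrier exceeds x plus the exponent of the moment bound by a spare (ε/2) x/(α log x), up to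
  -- lower order terms. This limit says that the spare part beats D(x) + 2 log x + C, so that
  -- Markov's inequality leaves e^{-x - 2 log x} = 1/(n log² n).
  have hlim : Tendsto (fun x : ℝ => (α + 1 + 2) * (α * (Real.log x ^ 2 / x)) + C * α *
      (Real.log x / x)) atTop (𝓝 ((α + 1 + 2) * (α * 0) + C * α * 0)) :=
    (tendsto_const_nhds.mul (tendsto_const_nhds.mul
      (Real.isLittleO_pow_log_id_atTop (n := 2)).tendsto_div_nhds_zero)).add
      (tendsto_const_nhds.mul Real.isLittleO_log_id_atTop.tendsto_div_nhds_zero)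
  have hbound : ∀ᶠ n in atTop, μ.real (bad n) ≤ 1 / ((n : ℝ) * Real.log n ^ 2) := by
    filter_upwards [hC, tendsto_log_nat.eventually (hlim.eventually_lt_const
      (show (α + 1 + 2) * (α * 0) + C * α * 0 < ε / 2 by simpa using hε)),
      tendsto_log_nat.eventually_gt_atTop 1, eventually_gt_atTop n₀,
      tendsto_log_nat.eventually (hE.cost.eventually_div_log_lt (c := α + 1) (by linarith)),
      tendsto_log_nat.eventually ((hE.cost.tendsto_atTop hα).eventually_ge_atTop 0)]
      with n h1 h2 h3 h4 h5 h6
    obtain ⟨k, rfl⟩ : ∃ k, n = k + 1 := ⟨n - 1, by omega⟩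
    set n := k + 1 with hn
    set x := Real.log (n : ℝ) with hx
    have hlx := Real.log_pos h3
    have hx0 : 0 < x := by linarith
    have hn0 : (0 : ℝ) < n := by exact_mod_cast (by omega : 0 < n)
    rw [div_lt_iff₀ hlx] at h5
    have hmom := hK.integral_exp_pathSum_le hw hw1 f (show 1 ≤ k by omega)
    have hfn : f n = WRT.cost α E x := by rw [hf, labelCost, if_pos h4]
    have hp : ∀ i, 1 ≤ i → 0 ≤ w i / totalWeight w i := fun i hi =>
      div_nonneg (hw i hi) (totalWeight_pos hw hw1 hi).le
    have hT : ∑ i ∈ Finset.Icc 2 k, (Real.exp (f i) - 1) * (w i / totalWeight w i) ≤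
        (1 + ε / 2) * (x / (α * Real.log x)) + C := by
      refine le_trans ?_ h1
      rw [hn, Finset.sum_Icc_succ_top (by omega)]
      refine le_add_of_nonneg_right (mul_nonneg ?_ (hp _ (by omega)))
      rw [← hn, hfn]
      linarith [Real.add_one_le_exp (WRT.cost α E x)]
    have hint : Integrable (fun ω => Real.exp (pathSum f (fun i => K i ω) n)) μ :=
      hK.integrable (n := n)
        (Real.measurable_exp.comp (hK.measurable_pathSum f (show 1 ≤ n by omega) le_rfl))
    have hmarkov := mul_meas_ge_le_integral_of_nonneg
      (Eventually.of_forall fun ω => (Real.exp_pos _).le) hint (Real.exp (barrier α ε x))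
    simp only [Real.exp_le_exp] at hmarkov
    change Real.exp (barrier α ε x) * μ.real (bad n) ≤ _ at hmarkov
    have h7 := hmarkov.trans hmom
    rw [← le_div_iff₀' (Real.exp_pos _), ← Real.exp_sub] at h7
    have h8 : 1 / ((n : ℝ) * x ^ 2) = Real.exp (-x - 2 * Real.log x) := by
      rw [Real.exp_sub, Real.exp_neg, hx, Real.exp_log hn0, ← hx,
        show (2 : ℝ) * Real.log x = ((2 : ℕ) : ℝ) * Real.log x by norm_num, Real.exp_nat_mul,
        Real.exp_log hx0]
      field_simp
    rw [h8]
    refine h7.trans (Real.exp_le_exp.2 ?_)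
    have h9 : (α + 1 + 2) * Real.log x + C ≤ ε / 2 * (x / (α * Real.log x)) := by
      have h10 := mul_le_mul_of_nonneg_right h2.le (show 0 ≤ x / (α * Real.log x) by positivity)
      refine le_trans (le_of_eq ?_) h10
      field_simp
    rw [← hn, hfn, barrier]
    linarith
  filter_upwards [ae_eventually_notMem_of_summable summable_one_div_mul_log_sq hbound] with ω hω
  refine hdet _ (hK.isParentMap ω) ?_
  -- The finitely many labels above the barrier are absorbed in a random additive constant, which
  -- the deterministic bound allows.
  have hbdd : IsBoundedUnder (· ≤ ·) atTop
      (fun m : ℕ => pathSum f (fun i => K i ω) m - barrier α ε (Real.log m)) :=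
    ⟨0, by
      rw [eventually_map]
      filter_upwards [hω] with m hm
      have : ¬ barrier α ε (Real.log m) ≤ pathSum f (fun i => K i ω) m := hm
      linarith [not_le.1 this]⟩
  obtain ⟨B, hB⟩ := hbdd.bddAbove_range
  refine ⟨B, fun m _ => ?_⟩
  have := hB ⟨m, rfl⟩
  simp only at this
  linarith

end Upper

/-! ### Expansion of the profile -/

section Expansion

variable {α : ℝ} {L : ℝ → ℝ}

/-- Σ u^k = 1/(1 - u) and Σ (k + 1) u^k = 1/(1 - u)², with u = log L/Λ. -/
lemma hasSum_seriesTerm {n : ℕ}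
    (hu : |Real.log (L (Real.log n)) / (α * Real.log (Real.log n))| < 1) :
    HasSum (seriesTerm α L n)
      (Real.log (L (Real.log n)) /
          (1 - Real.log (L (Real.log n)) / (α * Real.log (Real.log n))) +
        Real.log (Real.log (Real.log n)) /
          (1 - Real.log (L (Real.log n)) / (α * Real.log (Real.log n))) ^ 2) := by
  set l := Real.log (L (Real.log n))
  set u := l / (α * Real.log (Real.log n))
  set v := Real.log (Real.log (Real.log n))
  have h1 := hasSum_geometric_of_norm_lt_one (ξ := u) hu
  have h2 := hasSum_coe_mul_geometric_of_norm_lt_one (r := u) hu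
  have hne : 1 - u ≠ 0 := by
    have := (abs_lt.1 hu).2
    linarith
  have h3 := (h1.mul_left (l + v)).add (h2.mul_left v)
  have hsum : l / (1 - u) + v / (1 - u) ^ 2 = (l + v) * (1 - u)⁻¹ + v * (u / (1 - u) ^ 2) := by
    field_simp
    ring
  rw [hsum]
  refine h3.congr_fun fun k => ?_
  change u ^ k * (l + ((k : ℝ) + 1) * v) = _
  ring

lemma tendsto_log_div_mul_log (hα : 0 < α) (hL_pos : ∀ x, 1 ≤ x → 0 < L x) (hL : SV 2 L) :
    Tendsto (fun x => Real.log (L x) / (α * Real.log x)) atTop (𝓝 0) := by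
  have h := (logLike_logDensity (α := α) hL_pos hL).tendsto_div_mul_log hα
  have h2 := (tendsto_const_nhds (x := (1 : ℝ))).sub h
  rw [sub_self] at h2
  refine h2.congr' ?_
  filter_upwards [eventually_gt_atTop 1] with x hx
  have hl := Real.log_pos hx
  rw [logDensity]
  field_simp
  ring

lemma tendsto_sq_log_log_add_div (a : ℝ) :
    Tendsto (fun x => (Real.log (Real.log x) + a) ^ 2 / Real.log x) atTop (𝓝 0) := by
  have h1 := (Real.isLittleO_pow_log_id_atTop (n := 2)).tendsto_div_nhds_zero
  have h2 := Real.isLittleO_log_id_atTop.tendsto_div_nhds_zero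
  have h3 : Tendsto (fun y : ℝ => a ^ 2 / y) atTop (𝓝 0) := tendsto_const_nhds.div_atTop tendsto_id
  have h4 := (h1.add (h2.const_mul (2 * a))).add h3
  rw [mul_zero, add_zero, add_zero] at h4
  refine (h4.comp Real.tendsto_log_atTop).congr fun x => ?_
  simp only [Function.comp, id]
  ring

/-- Algebraic expansion of `x / D(x)`. -/
lemma expansion_identity {x Λ l v a α D : ℝ} (hx : x ≠ 0) (hΛ : Λ ≠ 0) (hE : Λ - l ≠ 0)
    (hD : D = Λ - l - v - a) (hD0 : D ≠ 0) :
    (x / D + (1 + α + 0) * (x / Λ ^ 2) - x / Λ) / (x / Λ ^ 2) -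
        (l / (1 - l / Λ) + v / (1 - l / Λ) ^ 2 + 1 + α + a) =
      (Λ / (Λ - l)) ^ 2 * ((v + a) ^ 2 / D) + a * ((Λ / (Λ - l)) ^ 2 - 1) := by
  have h1 : 1 - l / Λ = (Λ - l) / Λ := by field_simp
  have hl : l = Λ - (D + v + a) := by rw [hD]; ring
  have hE' : D + v + a ≠ 0 := by
    have : Λ - l = D + v + a := by rw [hl]; ring
    rwa [← this]
  rw [h1, hl]
  have h2 : Λ - (Λ - (D + v + a)) = D + v + a := by ring
  rw [h2]
  field_simp
  ring

/-- Both terms of the exact remainder vanish: Λ/E → 1, and (log log x + log α)² is negligible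
against D ~ α log x. -/
lemma tendsto_profile_sub_series (hα : 0 < α) (hL_pos : ∀ x, 1 ≤ x → 0 < L x) (hL : SV 2 L) :
    Tendsto (fun n : ℕ => (profile α (logDensity α L) 0 (Real.log n) -
        Real.log n / (α * Real.log (Real.log n))) /
          (Real.log n / (α * Real.log (Real.log n)) ^ 2) -
        ((∑' k : ℕ, seriesTerm α L n k) + 1 + α + Real.log α)) atTop (𝓝 0) := by
  have hE : LogLike α (logDensity α L) := logLike_logDensity hL_pos hL
  have h1 := hE.tendsto_mul_log_div hα
  have h2 := (tendsto_sq_log_log_add_div (Real.log α)).mul (hE.cost.tendsto_mul_log_div hα)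
  have h3 : Tendsto (fun x => (α * Real.log x / logDensity α L x) ^ 2 *
      ((Real.log (Real.log x) + Real.log α) ^ 2 / cost α (logDensity α L) x) + Real.log α *
        ((α * Real.log x / logDensity α L x) ^ 2 - 1)) atTop (𝓝 0) := by
    have h4 := ((h1.pow 2).mul (h2.const_mul α⁻¹)).add
      (((h1.pow 2).sub_const 1).const_mul (Real.log α))
    simp only [zero_mul, mul_zero, one_pow, sub_self, add_zero] at h4
    refine h4.congr' ?_
    filter_upwards [eventually_gt_atTop 1] with x hx
    have hl := Real.log_pos hx
    congr 2
    field_simp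
  refine (h3.comp tendsto_log_nat).congr' ?_
  have hu := (tendsto_log_div_mul_log hα hL_pos hL).abs
  rw [abs_zero] at hu
  filter_upwards [tendsto_log_nat.eventually (hu.eventually_lt_const one_pos),
    tendsto_log_nat.eventually_gt_atTop 1,
    tendsto_log_nat.eventually ((hE.tendsto_atTop hα).eventually_gt_atTop 0),
    tendsto_log_nat.eventually ((hE.cost.tendsto_atTop hα).eventually_gt_atTop 0)]
    with n hn hn1 hE0 hD0
  have hll := Real.log_pos hn1
  rw [(hasSum_seriesTerm hn).tsum_eq, profile]
  exact (expansion_identity (by linarith) (by positivity) hE0.ne'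
    (by rw [cost, logDensity]) hD0.ne').symm

end Expansion

end WRT

end

/-! ### Combining the two bounds -/

theorem theorem1p1 {Ω : Type*} [MeasurableSpace Ω] (μ : Measure Ω) [IsProbabilityMeasure μ]
    (w : ℕ → ℝ) (hw_nonneg : ∀ i, 1 ≤ i → 0 ≤ w i) (hw_one : 0 < w 1)
    (K : ℕ → Ω → ℕ) (hK : WRT.IsWRT μ w K)
    (α : ℝ) (hα : 0 < α)
    (L : ℝ → ℝ) (hL_pos : ∀ x, 1 ≤ x → 0 < L x) (hL : WRT.SV 2 L)
    (ha : (fun n : ℕ => WRT.aSeq w n - ∫ x in (1 : ℝ)..Real.log n, x ^ (-α) * L x)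
      =o[atTop] fun n : ℕ =>
        Real.log n ^ (-1 - α) * Real.log (Real.log n) ^ 2 * L (Real.log n))
    (hsq_summable : Summable fun i : ℕ => w (i + 1) ^ 2 / WRT.totalWeight w (i + 1) ^ 2)
    (hsq : (fun n : ℕ => ∑' i : ℕ, w (n + i) ^ 2 / WRT.totalWeight w (n + i) ^ 2)
      =O[atTop] fun n : ℕ => 1 / (n : ℝ)) :
    (∀ᶠ n : ℕ in atTop, Summable (WRT.seriesTerm α L n)) ∧
    ∀ᵐ ω ∂μ, ∃ ε : ℕ → ℝ, Tendsto ε atTop (𝓝 0) ∧ ∀ᶠ n : ℕ in atTop,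
      (WRT.treeHeight (fun m => K m ω) n : ℝ) =
        Real.log n / (α * Real.log (Real.log n)) +
        Real.log n / (α * Real.log (Real.log n)) ^ 2 *
          ((∑' k : ℕ, WRT.seriesTerm α L n k) + 1 + α + Real.log α + ε n) := by
  have hE : WRT.LogLike α (WRT.logDensity α L) := WRT.logLike_logDensity hL_pos hL
  have hb := WRT.tendsto_windowMass hL_pos hL ha
  refine ⟨?_, ?_⟩
  · have hu := (WRT.tendsto_log_div_mul_log hα hL_pos hL).abs
    rw [abs_zero] at hu
    filter_upwards [WRT.tendsto_log_nat.eventually (hu.eventually_lt_const one_pos)] with n hn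
    exact (WRT.hasSum_seriesTerm hn).summable
  -- Only the countably many values c = 1/(q + 1) are used, so one null set serves for all of them.
  have hlow : ∀ᵐ ω ∂μ, ∀ q : ℕ, ∀ᶠ n : ℕ in atTop,
      WRT.profile α (WRT.logDensity α L) (-(1 / ((q : ℝ) + 1))) (Real.log n) ≤
        WRT.treeHeight (fun i => K i ω) n := ae_all_iff.2 fun q =>
    hK.ae_eventually_profile_le hE hα hw_nonneg hw_one hsq_summable hsq hb (by positivity)
  have hup : ∀ᵐ ω ∂μ, ∀ q : ℕ, ∀ᶠ n : ℕ in atTop,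
      (WRT.treeHeight (fun i => K i ω) n : ℝ) ≤
        WRT.profile α (WRT.logDensity α L) (1 / ((q : ℝ) + 1)) (Real.log n) :=
    ae_all_iff.2 fun q =>
      hK.ae_eventually_le_profile hE hα hw_nonneg hw_one hb (by positivity)
  filter_upwards [hlow, hup] with ω hω1 hω2
  set H : ℕ → ℝ := fun n => WRT.treeHeight (fun m => K m ω) n with hH
  set s : ℕ → ℝ := fun n => Real.log n / (α * Real.log (Real.log n)) ^ 2 with hs
  have hs0 : ∀ᶠ n in atTop, 0 < s n := by
    filter_upwards [WRT.tendsto_log_nat.eventually_gt_atTop 1] with n hn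
    have h1 := Real.log_pos hn
    have h2 : 0 < Real.log n := by linarith
    simp only [hs]
    positivity
  -- The profiles with parameters ±c differ from the one with c = 0 by exactly ±c s(n).
  have hdev : Tendsto (fun n => (H n - WRT.profile α (WRT.logDensity α L) 0 (Real.log n)) / s n)
      atTop (𝓝 0) := by
    rw [Metric.tendsto_nhds]
    intro δ hδ
    obtain ⟨q, hq⟩ := exists_nat_one_div_lt hδ
    filter_upwards [hω1 q, hω2 q, hs0] with n h1 h2 h3
    rw [Real.dist_eq, sub_zero]
    refine lt_of_le_of_lt ?_ hq
    rw [abs_le, le_div_iff₀ h3, div_le_iff₀ h3]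
    simp only [WRT.profile] at h1 h2 ⊢
    simp only [hs, hH]
    constructor <;> linarith
  -- The error is defined by solving the claimed identity for it, so only its convergence to 0 has
  -- content.
  refine ⟨fun n => (H n - Real.log n / (α * Real.log (Real.log n))) / s n -
    ((∑' k : ℕ, WRT.seriesTerm α L n k) + 1 + α + Real.log α), ?_, ?_⟩
  · have h1 := hdev.add (WRT.tendsto_profile_sub_series hα hL_pos hL)
    rw [add_zero] at h1
    refine h1.congr fun n => ?_
    simp only [hs]
    ring
  · filter_upwards [hs0] with n hn
    rw [add_sub_cancel]
    change H n = _ + s n * ((H n - _) / s n)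
    rw [mul_div_cancel₀ _ hn.ne']
    ring
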